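/- Let $n,d\ge 1$ be integers, $\alpha>0$ and $1\le p<\infty$, and let $p'$ be the conjugate exponent of $p$ (so $1'=\infty$). Let $W$ be a $d\times d$ matrix weight on $\mathbb C^n$, i.e. a matrix-valued function such that $W(z)$ is positive and invertible for almost every $z$ and $W$, $W^{-1}$ are locally integrable. Let $v$ be Lebesgue measure on $\mathbb C^n$, and let $L^p_{\alpha,W}(\mathbb C^n;\mathbb C^d)$ be the space of measurable $f:\mathbb C^n\to\mathbb C^d$ with $$\|f\|^p_{L^p_{\alpha,W}}=\int_{\mathbb C^n}|W^{1/p}(z)f(z)|^p e^{-\frac{p\alpha}{2}|z|^2}\,dv(z)<\infty ;$$ for $W\equiv I$ the subscript $W$ is omitted. With $d\lambda_\alpha(u)=(\alpha/\pi)^n e^{-\alpha|u|^2}dv(u)$ and $K^\alpha_z(u)=e^{\alpha\langle u,z\rangle}$ put $$P_\alpha f(z)=\int_{\mathbb C^n} f(u)\overline{K^\alpha_z(u)}\,d\lambda_\alpha(u),\qquad P^+_{\alpha,W}f(z)=\int_{\mathbb C^n}\big|W^{1/p}(z)W^{-1/p}(u)f(u)\big|\,|K^\alpha_z(u)|\,d\lambda_\alpha(u).$$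 That $P_\alpha$ is bounded on $L^p_{\alpha,W}(\mathbb C^n;\mathbb C^d)$ means that for all $f$ in this space the integral $P_\alpha f(z)$ converges absolutely for every $z$ and $\|P_\alpha f\|\le C\|f\|$ with some $C<\infty$ independent of $f$. Let $\rho_z(x)=|W^{1/p}(z)x|$ for $x\in\mathbb C^d$. For a norm $N$ on $\mathbb C^d$ let $N^*(x)=\sup_{y\ne0}|\langle x,y\rangle|/N(y)$, and let $\rho^*_z=(\rho_z)^*$. For a cube $Q\subset\mathbb C^n=\mathbb R^{2n}$ (with sides parallel to the axes) let $$\rho_{p,Q}(x)=\Big(\tfrac1{v(Q)}\int_Q\rho_z(x)^p\,dv(z)\Big)^{1/p},$$ and let $\rho^*_{p',Q}(x)$ be the same average of $\rho^*_z(x)$ with exponent $p'$, read as $\operatorname{ess\,sup}_{z\in Q}\rho^*_z(x)$ if $p'=\infty$. For $r>0$, $W$ is an $\mathcal A_{p,r}$-weight if there is $C<\infty$ with $\rho^*_{p',Q}(x)\le C\,(\rho_{p,Q})^*(x)$ for all $x\in\mathbb C^d$ and all cubes $Q$ of side length $r$; the least such $C$ is $\mathcal C_{p,r}(W)$. **Theorem.**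 The following are equivalent: (a) $P_\alpha$ is bounded on $L^p_{\alpha,W}(\mathbb C^n;\mathbb C^d)$; (b) $P^+_{\alpha,W}:L^p_\alpha(\mathbb C^n;\mathbb C^d)\to L^p_\alpha(\mathbb C^n;\mathbb C)$ is bounded; (c) $W$ is an $\mathcal A_{p,r}$-weight for every $r>0$; (d) $W$ is an $\mathcal A_{p,r}$-weight for some $r>0$. Moreover, for every $r>0$ there is a constant $c>0$, depending only on $\alpha,p,r,n$ (not on $d$ or $W$), such that $$\Big(\frac{\alpha r^2}{\pi}\Big)^n e^{-n\alpha r^2}\,\mathcal C_{p,r}(W)^{1/2}\le\|P_\alpha\|\le\|P^+_{\alpha,W}\|\le c\,d^{c_p}\,\mathcal C_{p,r}(W)^{c(1+\log \mathcal C_{p,r}(W))},$$ where $c_p=7/2$ for $1<p<\infty$ and $c_1=9/2$. Here norms of unbounded operators, and $\mathcal C_{p,r}(W)$ if $W$ is not an $\mathcal A_{p,r}$-weight, are $\infty$. -/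

import Mathlib

open MeasureTheory
open scoped ENNReal NNReal ComplexConjugate ComplexOrder

noncomputable section

namespace Fock

/-- The domain `ℂⁿ`, carrying `2n`-dimensional Lebesgue measure `volume`. The sup norm of this
type is never used: the Hermitian form and Euclidean norm are `herm` and `sqNorm` below. -/
abbrev Cn (n : ℕ) : Type := Fin n → ℂ

/-- The target `ℂᵈ` with its Hilbert space norm. -/
abbrev Cd (d : ℕ) : Type := EuclideanSpace ℂ (Fin d)

/-- `⟨u, z⟩ = ∑ uⱼ z̄ⱼ` on `ℂⁿ`. -/
def herm {n : ℕ} (u z : Cn n) : ℂ := ∑ j, u j * conj (z j)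

/-- `|z|² = ∑ |zⱼ|²` on `ℂⁿ`. -/
def sqNorm {n : ℕ} (z : Cn n) : ℝ := ∑ j, ‖z j‖ ^ 2

/-- The cube `Q_r(u)` in `ℂⁿ = ℝ²ⁿ` with centre `u`, side length `r` and sides parallel to the
coordinate axes. -/
def cube {n : ℕ} (r : ℝ) (u : Cn n) : Set (Cn n) :=
  {z | ∀ j, |(z j - u j).re| ≤ r / 2 ∧ |(z j - u j).im| ≤ r / 2}

/-- `W` is a `d × d` matrix weight on `ℂⁿ`: almost everywhere positive and invertible, with `W`
and `W⁻¹` locally integrable (i.e. all entries are; this includes measurability of `W`). -/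
structure IsMatrixWeight {n d : ℕ} (W : Cn n → Matrix (Fin d) (Fin d) ℂ) : Prop where
  posDef : ∀ᵐ z, (W z).PosDef
  locallyIntegrable : ∀ i j, LocallyIntegrable (fun z => W z i j) volume
  locallyIntegrable_inv : ∀ i j, LocallyIntegrable (fun z => (W z)⁻¹ i j) volume

/-- The real power `Mˢ` of a positive definite matrix, as an operator on `ℂᵈ`
(functional calculus). -/
def mpow {d : ℕ} (M : Matrix (Fin d) (Fin d) ℂ) (s : ℝ) : Cd d →L[ℂ] Cd d :=
  Matrix.toEuclideanCLM (𝕜 := ℂ) (cfc (fun t : ℝ => t ^ s) M)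

/-- For `g ≥ 0` on `ℂⁿ`, the quantity `(∫ g(z)^p e^{-(pα/2)|z|²} dv(z))^{1/p}`. -/
def lpNorm {n : ℕ} (α p : ℝ) (g : Cn n → ℝ≥0∞) : ℝ≥0∞ :=
  (∫⁻ z, g z ^ p * ENNReal.ofReal (Real.exp (-(p * α / 2) * sqNorm z))) ^ (1 / p)

/-- The norm of `f` in `L^p_α(ℂⁿ; ℂᵈ)`. -/
def normLp {n d : ℕ} (α p : ℝ) (f : Cn n → Cd d) : ℝ≥0∞ :=
  lpNorm α p fun z => ‖f z‖ₑ

/-- The norm of `f` in the weighted space `L^p_{α,W}(ℂⁿ; ℂᵈ)`. -/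
def normLpW {n d : ℕ} (α p : ℝ) (W : Cn n → Matrix (Fin d) (Fin d) ℂ) (f : Cn n → Cd d) : ℝ≥0∞ :=
  lpNorm α p fun z => ‖mpow (W z) (1 / p) (f z)‖ₑ

/-- `f ∈ L^p_α(ℂⁿ; ℂᵈ)`. -/
def InLp {n d : ℕ} (α p : ℝ) (f : Cn n → Cd d) : Prop :=
  AEStronglyMeasurable f volume ∧ normLp α p f < ∞

/-- `f ∈ L^p_{α,W}(ℂⁿ; ℂᵈ)`. -/
def InLpW {n d : ℕ} (α p : ℝ) (W : Cn n → Matrix (Fin d) (Fin d) ℂ) (f : Cn n → Cd d) : Prop :=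
  AEStronglyMeasurable f volume ∧ normLpW α p W f < ∞

/-- The Gaussian measure `dλ_α(u) = (α/π)ⁿ e^{-α|u|²} dv(u)`. -/
def gaussian (n : ℕ) (α : ℝ) : Measure (Cn n) :=
  volume.withDensity fun u =>
    ENNReal.ofReal ((α / Real.pi) ^ n * Real.exp (-α * sqNorm u))

/-- The reproducing kernel `K^α_z(u) = e^{α⟨u,z⟩}`. -/
def kernel {n : ℕ} (α : ℝ) (z u : Cn n) : ℂ := Complex.exp (α * herm u z)

/-- The Fock projection `P_α f(z) = ∫ f(u) conj(K^α_z(u)) dλ_α(u)`. -/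
def fockProj {n d : ℕ} (α : ℝ) (f : Cn n → Cd d) (z : Cn n) : Cd d :=
  ∫ u, conj (kernel α z u) • f u ∂(gaussian n α)

/-- The maximal Fock projection
`P⁺_{α,W} f(z) = ∫ |W^{1/p}(z) W^{-1/p}(u) f(u)| |K^α_z(u)| dλ_α(u)`, a priori in `[0,∞]`. -/
def maxFockProj {n d : ℕ} (α p : ℝ) (W : Cn n → Matrix (Fin d) (Fin d) ℂ) (f : Cn n → Cd d)
    (z : Cn n) : ℝ≥0∞ :=
  ∫⁻ u, ‖mpow (W z) (1 / p) (mpow (W u) (-(1 / p)) (f u))‖ₑ * ‖kernel α z u‖ₑ ∂(gaussian n α)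

/-- `P_α` is defined on all of `L^p_{α,W}(ℂⁿ; ℂᵈ)` (its integral converges absolutely at every
point) and maps this space into itself with bound `C`. -/
def FockProjBound {n d : ℕ} (α p : ℝ) (W : Cn n → Matrix (Fin d) (Fin d) ℂ) (C : ℝ≥0) : Prop :=
  ∀ f : Cn n → Cd d, InLpW α p W f →
    (∀ z, Integrable (fun u => conj (kernel α z u) • f u) (gaussian n α)) ∧
    AEStronglyMeasurable (fockProj α f) volume ∧
    normLpW α p W (fockProj α f) ≤ C * normLpW α p W f

/-- `P_α` is bounded on `L^p_{α,W}(ℂⁿ; ℂᵈ)`. -/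
def FockProjBounded {n d : ℕ} (α p : ℝ) (W : Cn n → Matrix (Fin d) (Fin d) ℂ) : Prop :=
  ∃ C : ℝ≥0, FockProjBound α p W C

/-- The operator norm `‖P_α‖` on `L^p_{α,W}(ℂⁿ; ℂᵈ)`, equal to `∞` if `P_α` is not bounded. -/
def fockProjNorm {n d : ℕ} (α p : ℝ) (W : Cn n → Matrix (Fin d) (Fin d) ℂ) : ℝ≥0∞ :=
  ⨅ (C : ℝ≥0) (_ : FockProjBound α p W C), (C : ℝ≥0∞)

/-- `P⁺_{α,W}` maps `L^p_α(ℂⁿ; ℂᵈ)` into `L^p_α(ℂⁿ; ℂ)` with bound `C` (in particular its values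
are finite almost everywhere). -/
def MaxFockProjBound {n d : ℕ} (α p : ℝ) (W : Cn n → Matrix (Fin d) (Fin d) ℂ) (C : ℝ≥0) : Prop :=
  ∀ f : Cn n → Cd d, InLp α p f →
    AEMeasurable (maxFockProj α p W f) volume ∧
    lpNorm α p (maxFockProj α p W f) ≤ C * normLp α p f

/-- `P⁺_{α,W} : L^p_α(ℂⁿ; ℂᵈ) → L^p_α(ℂⁿ; ℂ)` is bounded. -/
def MaxFockProjBounded {n d : ℕ} (α p : ℝ) (W : Cn n → Matrix (Fin d) (Fin d) ℂ) : Prop :=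
  ∃ C : ℝ≥0, MaxFockProjBound α p W C

/-- The norm `‖P⁺_{α,W}‖`, equal to `∞` if `P⁺_{α,W}` is not bounded. -/
def maxFockProjNorm {n d : ℕ} (α p : ℝ) (W : Cn n → Matrix (Fin d) (Fin d) ℂ) : ℝ≥0∞ :=
  ⨅ (C : ℝ≥0) (_ : MaxFockProjBound α p W C), (C : ℝ≥0∞)

/-- The dual norm `N*(x) = sup_{y ≠ 0} |⟨x,y⟩| / N(y)`. -/
def dualNorm {d : ℕ} (N : Cd d → ℝ≥0∞) (x : Cd d) : ℝ≥0∞ :=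
  ⨆ (y : Cd d) (_ : y ≠ 0), ‖inner ℂ x y‖ₑ / N y

/-- The averaged norm `ρ_{q,Q}(x)`: the `L^q` norm of `z ↦ ρ_z(x)` over `Q` with respect to
normalized Lebesgue measure, that is `((1/v(Q)) ∫_Q ρ_z(x)^q dv(z))^{1/q}` for `1 ≤ q < ∞` and
the essential supremum over `Q` for `q = ∞`. -/
def avgNorm {n d : ℕ} (ρ : Cn n → Cd d → ℝ≥0∞) (q : ℝ≥0∞) (Q : Set (Cn n)) (x : Cd d) : ℝ≥0∞ :=
  eLpNorm (fun z => ρ z x) q ((volume Q)⁻¹ • volume.restrict Q)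

/-- `ρ*_{p',Q}(x) ≤ C (ρ_{p,Q})*(x)` for all `x` and all cubes `Q` of side length `r`, where
`p'` is the conjugate exponent of `p` (so `1' = ∞`). -/
def AprBound {n d : ℕ} (p r : ℝ) (ρ : Cn n → Cd d → ℝ≥0∞) (C : ℝ≥0) : Prop :=
  ∀ (x : Cd d) (u : Cn n),
    avgNorm (fun z => dualNorm (ρ z)) (ENNReal.ofReal p).conjExponent (cube r u) x ≤
      C * dualNorm (avgNorm ρ (ENNReal.ofReal p) (cube r u)) x

/-- The metric `ρ_z(x) = |W^{1/p}(z) x|` of a matrix weight. -/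
def weightMetric {n d : ℕ} (p : ℝ) (W : Cn n → Matrix (Fin d) (Fin d) ℂ) :
    Cn n → Cd d → ℝ≥0∞ :=
  fun z x => ‖mpow (W z) (1 / p) x‖ₑ

/-- `W` is an `A_{p,r}`-weight. -/
def IsAprWeight {n d : ℕ} (p r : ℝ) (W : Cn n → Matrix (Fin d) (Fin d) ℂ) : Prop :=
  ∃ C : ℝ≥0, 0 < C ∧ AprBound p r (weightMetric p W) C

/-- The `A_{p,r}`-constant `C_{p,r}(W)`: the least suitable `C`, and `∞` if there is none. -/
def aprConst {n d : ℕ} (p r : ℝ) (W : Cn n → Matrix (Fin d) (Fin d) ℂ) : ℝ≥0∞ :=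
  ⨅ (C : ℝ≥0) (_ : AprBound p r (weightMetric p W) C), (C : ℝ≥0∞)

/-- The exponent of the dimension: `c_1 = 9/2` and `c_p = 7/2` for `p > 1`. -/
def dimExp (p : ℝ) : ℝ := if p = 1 then 9 / 2 else 7 / 2

end Fock

end

/-! Lower estimate. Let `a` be the centre of a cube. Multiplying by suitable exponentials before and
after `P_α` turns its kernel into `e^{t}` with `t = α⟨z-a, u-a⟩`, times the indicator of the cube in
`u`. The remaining factor `e^{t}` is undone on a cube of any side: `e^{-t}` is expanded in its power
series, and `⟨z-a, u-a⟩^m` is a sum of `n^m` products of a monomial in `z - a` and a conjugate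
monomial in `u - a`, so each term is again `P_α` between two multiplication operators. Summing the
norms shows that averaging over the cube is bounded, with constant `(π/(αr²))^n e^{nαr²} ‖P_α‖`
(`primalAvg_average_le`). Pairing averages of suitable functions with a vector `x` yields the
`A_{p,r}` inequality with the same constant, by `L^p`-`L^{p'}` duality
(`dualAvg_le_of_fockProjBound`). This bounds `𝒞_{p,r}` itself, and the square root is weaker because
`𝒞_{p,r} ≥ 1`.

Upper estimate. After multiplication by the square root of the Gaussian, `P⁺_{α,W}` has the kernel
`(α/π)^n e^{-α|z-u|²/2}` acting on `|W^{1/p}(z)W^{-1/p}(u)f(u)|`. Space is cut into cells of side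
`r`. For overlapping cubes whose centres differ by at most `r/2` in each real coordinate, the dual
norms `(ρ_{p,Q})*` are comparable up to `16^n C` (`dualNorm_primalAvg_le_of_near`), so a chain of
`N` steps costs `(16^n C)^N`. Here `N` is linear in the difference of cell indices, while the
Gaussian decays quadratically. Completing the square absorbs the chain at the price `exp(const ·
log²(16^n C))` (`exp_mul_pow_le`), which is the origin of the exponent `c(1 + log C)`.

The product `W^{1/p}(z)W^{-1/p}(u)` is decoupled by expanding in a nearly Auerbach basis of
`ρ_{p,Q}` for the cell of `z`: there are `d` rank-one terms, each handled by Hölder's inequality on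
the cell of `u` and the `A_{p,r}` condition. What remains is a discrete convolution with a summable
Gaussian sequence, bounded by Young's inequality. The dimension enters only linearly, so the
exponent `c_p` is met with room to spare.

Finally `P⁺_{α,W}` dominates `P_α`. The lower estimate holds for every `r` and the upper one needs a
single `r`, which closes the circle of equivalences. -/

noncomputable section

namespace Fock

/-! ### Real powers of positive definite matrices: algebra, measurability, duality -/

section MatrixPower

open Filter Topology Polynomial

variable {d : ℕ} {M : Matrix (Fin d) (Fin d) ℂ}

theorem spectrum_pos (hM : M.PosDef) {x : ℝ} (hx : x ∈ spectrum ℝ M) : 0 < x := by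
  rw [hM.1.spectrum_real_eq_range_eigenvalues] at hx
  obtain ⟨i, rfl⟩ := hx
  exact hM.eigenvalues_pos i

theorem continuousOn_rpow_spectrum (hM : M.PosDef) (s : ℝ) :
    ContinuousOn (fun t : ℝ => t ^ s) (spectrum ℝ M) := fun x hx =>
  (Real.continuousAt_rpow_const x s (Or.inl (spectrum_pos hM hx).ne')).continuousWithinAt

theorem mpow_mpow (hM : M.PosDef) (s t : ℝ) (x : Cd d) :
    mpow M s (mpow M t x) = mpow M (s + t) x := by
  have hsa : IsSelfAdjoint M := hM.1
  have h : cfc (fun u : ℝ => u ^ (s + t)) M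
      = cfc (fun u : ℝ => u ^ s) M * cfc (fun u : ℝ => u ^ t) M := by
    rw [← cfc_mul _ _ M (continuousOn_rpow_spectrum hM s) (continuousOn_rpow_spectrum hM t)]
    exact cfc_congr fun u hu => Real.rpow_add (spectrum_pos hM hu) s t
  simp only [mpow, h, map_mul]
  rfl

theorem mpow_zero (hM : M.PosDef) (x : Cd d) : mpow M 0 x = x := by
  have hsa : IsSelfAdjoint M := hM.1
  have h : cfc (fun u : ℝ => u ^ (0 : ℝ)) M = 1 := by
    simp only [Real.rpow_zero]
    exact cfc_const_one ℝ M
  rw [mpow, h, map_one]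
  rfl

theorem mpow_mpow_neg (hM : M.PosDef) (s : ℝ) (x : Cd d) : mpow M s (mpow M (-s) x) = x := by
  rw [mpow_mpow hM, add_neg_cancel, mpow_zero hM]

theorem mpow_neg_mpow (hM : M.PosDef) (s : ℝ) (x : Cd d) : mpow M (-s) (mpow M s x) = x := by
  rw [mpow_mpow hM, neg_add_cancel, mpow_zero hM]

theorem mpow_eq_zero (hM : M.PosDef) {s : ℝ} {x : Cd d} : mpow M s x = 0 ↔ x = 0 :=
  ⟨fun h => by rw [← mpow_neg_mpow hM s x, h, map_zero], fun h => by rw [h, map_zero]⟩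

theorem inner_mpow (M : Matrix (Fin d) (Fin d) ℂ) (s : ℝ) (x y : Cd d) :
    inner ℂ (mpow M s x) y = inner ℂ x (mpow M s y) := by
  have h : IsSelfAdjoint (mpow M s) := (cfc_predicate (R := ℝ) _ M).map _
  exact ContinuousLinearMap.isSelfAdjoint_iff_isSymmetric.1 h x y

open scoped Matrix.Norms.L2Operator in
-- The largest eigenvalue is at most the trace. The trace is linear in the entries, so it is
-- integrable over cubes together with them.
theorem norm_mpow_le (hM : M.PosDef) {s : ℝ} (hs : 0 ≤ s) : ‖mpow M s‖ ≤ M.trace.re ^ s := by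
  have htr : M.trace.re = ∑ i, hM.1.eigenvalues i := by
    rw [hM.1.trace_eq_sum_eigenvalues]; simp
  have h0 : 0 ≤ M.trace.re := htr ▸ Finset.sum_nonneg fun i _ => (hM.eigenvalues_pos i).le
  rw [mpow, Matrix.l2_opNorm_toEuclideanCLM]
  refine norm_cfc_le (Real.rpow_nonneg h0 s) fun x hx => ?_
  have hx0 := (spectrum_pos hM hx).le
  rw [Real.norm_of_nonneg (Real.rpow_nonneg hx0 s)]
  refine Real.rpow_le_rpow hx0 ?_ hs
  rw [hM.1.spectrum_real_eq_range_eigenvalues] at hx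
  obtain ⟨i, rfl⟩ := hx
  rw [htr]
  exact Finset.single_le_sum (f := hM.1.eigenvalues)
    (fun i _ => (hM.eigenvalues_pos i).le) (Finset.mem_univ i)

theorem continuous_toEuclideanCLM :
    Continuous (Matrix.toEuclideanCLM (n := Fin d) (𝕜 := ℂ)) := by
  let f : Matrix (Fin d) (Fin d) ℂ →ₗ[ℂ] (Cd d →L[ℂ] Cd d) :=
    (Matrix.toEuclideanCLM (n := Fin d) (𝕜 := ℂ)).toAlgEquiv.toLinearMap
  exact f.continuous_of_finiteDimensional

/-- Powers of positive definite matrices are limits of polynomials with real coefficients. -/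
theorem exists_polynomial_tendsto_mpow (s : ℝ) :
    ∃ q : ℕ → ℝ[X], ∀ {d : ℕ} {M : Matrix (Fin d) (Fin d) ℂ}, M.PosDef →
      Tendsto (fun k => Matrix.toEuclideanCLM (𝕜 := ℂ) (aeval M (q k))) atTop
        (𝓝 (mpow M s)) := by
  -- The intervals `[1/(k+1), k+1]` exhaust `(0, ∞)`, so every spectrum eventually lies in them and
  -- one sequence of polynomials serves all matrices.
  have hq : ∀ k : ℕ, ∃ q : ℝ[X], ∀ x ∈ Set.Icc (1 / ((k : ℝ) + 1)) (k + 1),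
      |q.eval x - x ^ s| < 1 / ((k : ℝ) + 1) := fun k =>
    exists_polynomial_near_of_continuousOn _ _ _ (fun x hx =>
      (Real.continuousAt_rpow_const x s
        (Or.inl (lt_of_lt_of_le (by positivity) hx.1).ne')).continuousWithinAt) _ (by positivity)
  choose q hq using hq
  refine ⟨q, fun {d M} hM => ?_⟩
  have hsa : IsSelfAdjoint M := hM.1
  have hcfc : ∀ k, aeval M (q k) = cfc (fun x => (q k).eval x) M := fun k =>
    (cfc_polynomial (q k) M hsa).symm
  simp only [hcfc]
  refine (continuous_toEuclideanCLM.tendsto _).comp (tendsto_cfc_fun ?_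
    (Eventually.of_forall fun k => (q k).continuous.continuousOn))
  have hev : ∀ᶠ k : ℕ in atTop, ∀ x ∈ spectrum ℝ M,
      x ∈ Set.Icc (1 / ((k : ℝ) + 1)) (k + 1) := by
    rw [hM.1.spectrum_real_eq_range_eigenvalues]
    simp only [Set.forall_mem_range]
    refine eventually_all.2 fun i => ?_
    have h1 : ∀ᶠ k : ℕ in atTop, 1 / ((k : ℝ) + 1) ≤ hM.1.eigenvalues i :=
      tendsto_one_div_add_atTop_nhds_zero_nat.eventually_le_const (hM.eigenvalues_pos i)
    have h2 : ∀ᶠ k : ℕ in atTop, hM.1.eigenvalues i ≤ k :=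
      tendsto_natCast_atTop_atTop.eventually_ge_atTop _
    filter_upwards [h1, h2] with k hk1 hk2
    exact ⟨hk1, hk2.trans (by linarith)⟩
  rw [Metric.tendstoUniformlyOn_iff]
  intro ε hε
  filter_upwards [hev, tendsto_one_div_add_atTop_nhds_zero_nat.eventually_lt_const hε] with k hk hk2
  intro x hx
  rw [dist_comm, Real.dist_eq]
  exact (hq k x (hk x hx)).trans hk2

variable {Ω : Type*} [MeasurableSpace Ω] {μ : Measure Ω}

/-- The approximating polynomials do not depend on the point, so the power of `W` is an almost
everywhere limit of polynomials in `W`. -/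
theorem aestronglyMeasurable_mpow {W : Ω → Matrix (Fin d) (Fin d) ℂ}
    (hW : ∀ i j, AEStronglyMeasurable (fun z => W z i j) μ) (hpos : ∀ᵐ z ∂μ, (W z).PosDef)
    (s : ℝ) : AEStronglyMeasurable (fun z => mpow (W z) s) μ := by
  obtain ⟨q, hq⟩ := exists_polynomial_tendsto_mpow s
  have hW' : AEStronglyMeasurable W μ := by
    have : AEMeasurable (fun z => fun i j => W z i j) μ :=
      aemeasurable_pi_lambda _ fun i => aemeasurable_pi_lambda _ fun j => (hW i j).aemeasurable
    exact (show Continuous (fun f : Fin d → Fin d → ℂ => Matrix.of f) from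
      continuous_id).comp_aestronglyMeasurable this.aestronglyMeasurable
  refine aestronglyMeasurable_of_tendsto_ae atTop
    (f := fun k z => Matrix.toEuclideanCLM (𝕜 := ℂ) (aeval (W z) (q k))) (fun k => ?_) ?_
  · exact (continuous_toEuclideanCLM.comp (q k).continuous_aeval).comp_aestronglyMeasurable hW'
  · filter_upwards [hpos] with z hz using hq hz

theorem enorm_inner_le (x y : Cd d) : ‖inner ℂ x y‖ₑ ≤ ‖x‖ₑ * ‖y‖ₑ := by
  simp only [enorm_eq_nnnorm, ← ENNReal.coe_mul, ENNReal.coe_le_coe]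
  exact nnnorm_inner_le_nnnorm x y

theorem enorm_inner_self (x : Cd d) : ‖inner ℂ x x‖ₑ = ‖x‖ₑ * ‖x‖ₑ := by
  rw [inner_self_eq_norm_sq_to_K, sq, enorm_mul]
  simp [enorm_eq_nnnorm]

/-- Cauchy–Schwarz for `⟨x, y⟩ = ⟨M^{-s}x, M^s y⟩`, with equality at `y = M^{-2s}x`. -/
theorem dualNorm_mpow (hM : M.PosDef) (s : ℝ) (x : Cd d) :
    dualNorm (fun y => ‖mpow M s y‖ₑ) x = ‖mpow M (-s) x‖ₑ := by
  apply le_antisymm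
  · refine iSup₂_le fun y hy => ENNReal.div_le_of_le_mul ?_
    have h : inner ℂ x y = inner ℂ (mpow M (-s) x) (mpow M s y) := by
      rw [inner_mpow, mpow_neg_mpow hM]
    rw [h]
    exact enorm_inner_le _ _
  · rcases eq_or_ne x 0 with rfl | hx
    · simp
    set w := mpow M (-s) x with hw
    have hw0 : w ≠ 0 := fun h => hx ((mpow_eq_zero hM).1 h)
    have hy0 : mpow M (-s) w ≠ 0 := fun h => hw0 ((mpow_eq_zero hM).1 h)
    refine le_trans ?_ (le_iSup₂ (f := fun (y : Cd d) (_ : y ≠ 0) =>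
      ‖inner ℂ x y‖ₑ / ‖mpow M s y‖ₑ) (mpow M (-s) w) hy0)
    rw [mpow_mpow_neg hM, ← inner_mpow, ← hw, enorm_inner_self,
      ENNReal.mul_div_cancel_right (by simpa using hw0) (by simp)]

end MatrixPower

/-! ### Cubes and normalized Lebesgue measure on them -/

section Cubes

variable {n : ℕ} {r : ℝ} {u v : Cn n}

theorem cube_eq_pi (r : ℝ) (u : Cn n) :
    cube r u = Set.univ.pi fun j => Complex.measurableEquivRealProd ⁻¹'
      (Set.Icc ((u j).re - r / 2) ((u j).re + r / 2) ×ˢ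
        Set.Icc ((u j).im - r / 2) ((u j).im + r / 2)) := by
  ext z
  simp only [cube, Set.mem_ofPred_eq, Set.mem_pi, Set.mem_univ, true_imp_iff, Set.mem_preimage,
    Set.mem_prod, Set.mem_Icc, Complex.measurableEquivRealProd_apply, abs_le, Complex.sub_re,
    Complex.sub_im]
  refine forall_congr' fun j => ?_
  constructor
  · rintro ⟨⟨_, _⟩, _, _⟩; refine ⟨⟨?_, ?_⟩, ?_, ?_⟩ <;> linarith
  · rintro ⟨⟨_, _⟩, _, _⟩; refine ⟨⟨?_, ?_⟩, ?_, ?_⟩ <;> linarith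

theorem measurableSet_cube (r : ℝ) (u : Cn n) : MeasurableSet (cube r u) := by
  rw [cube_eq_pi]
  exact MeasurableSet.univ_pi fun j => Complex.measurableEquivRealProd.measurable
    (measurableSet_Icc.prod measurableSet_Icc)

theorem volume_cube (hr : 0 < r) (u : Cn n) : volume (cube r u) = ENNReal.ofReal ((r ^ 2) ^ n) := by
  have h : ∀ j, volume (Complex.measurableEquivRealProd ⁻¹'
      (Set.Icc ((u j).re - r / 2) ((u j).re + r / 2) ×ˢ
        Set.Icc ((u j).im - r / 2) ((u j).im + r / 2))) = ENNReal.ofReal (r ^ 2) := fun j => by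
    rw [Complex.volume_preserving_equiv_real_prod.measure_preimage
      (measurableSet_Icc.prod measurableSet_Icc).nullMeasurableSet, Measure.volume_eq_prod,
      Measure.prod_prod, Real.volume_Icc, Real.volume_Icc, ← ENNReal.ofReal_mul (by linarith)]
    congr 1; ring
  rw [cube_eq_pi, volume_pi_pi, Finset.prod_congr rfl fun j _ => h j, Finset.prod_const,
    Finset.card_univ, Fintype.card_fin, ENNReal.ofReal_pow (by positivity) n]

theorem volume_cube_ne_zero (hr : 0 < r) (u : Cn n) : volume (cube r u) ≠ 0 := by
  rw [volume_cube hr]; simp only [ne_eq, ENNReal.ofReal_eq_zero, not_le]; positivity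

theorem volume_cube_ne_top (hr : 0 < r) (u : Cn n) : volume (cube r u) ≠ ∞ := by
  rw [volume_cube hr]; exact ENNReal.ofReal_ne_top

theorem isCompact_cube (r : ℝ) (u : Cn n) : IsCompact (cube r u) := by
  rw [cube_eq_pi]
  refine isCompact_univ_pi fun j => ?_
  exact Complex.equivRealProdCLM.toHomeomorph.isCompact_preimage.2
    (isCompact_Icc.prod isCompact_Icc)

/-- By symmetry in `u` and `v`, the half-size cube at the midpoint lies in both cubes and serves to
compare their averages. -/
theorem cube_half_midpoint_subset
    (h : ∀ j, |(u j - v j).re| ≤ r / 2 ∧ |(u j - v j).im| ≤ r / 2) :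
    cube (r / 2) (fun j => (u j + v j) / 2) ⊆ cube r u := by
  intro z hz j
  have hz := hz j
  have h := h j
  simp only [Complex.sub_re, Complex.sub_im, Complex.div_ofNat_re, Complex.div_ofNat_im,
    Complex.add_re, Complex.add_im, abs_le] at hz h ⊢
  obtain ⟨⟨_, _⟩, _, _⟩ := hz
  obtain ⟨⟨_, _⟩, _, _⟩ := h
  refine ⟨⟨?_, ?_⟩, ?_, ?_⟩ <;> linarith

theorem sqNorm_sub_le_of_mem_cube {z : Cn n} (hz : z ∈ cube r u) :
    sqNorm (z - u) ≤ n * (r ^ 2 / 2) := by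
  have h : ∀ j, ‖(z - u) j‖ ^ 2 ≤ r ^ 2 / 2 := fun j => by
    rw [← Complex.normSq_eq_norm_sq, Complex.normSq_apply]
    have h1 := sq_le_sq' (abs_le.1 (hz j).1).1 (abs_le.1 (hz j).1).2
    have h2 := sq_le_sq' (abs_le.1 (hz j).2).1 (abs_le.1 (hz j).2).2
    simp only [Pi.sub_apply]
    nlinarith
  calc sqNorm (z - u) ≤ ∑ _j : Fin n, r ^ 2 / 2 := Finset.sum_le_sum fun j _ => h j
    _ = n * (r ^ 2 / 2) := by simp

/-- Normalized Lebesgue measure on a cube. -/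
def avgMeasure (r : ℝ) (u : Cn n) : Measure (Cn n) :=
  (volume (cube r u))⁻¹ • volume.restrict (cube r u)

theorem isProbabilityMeasure_avgMeasure (hr : 0 < r) (u : Cn n) :
    IsProbabilityMeasure (avgMeasure r u) := ⟨by
  rw [avgMeasure, Measure.smul_apply, Measure.restrict_apply_univ, smul_eq_mul,
    ENNReal.inv_mul_cancel (volume_cube_ne_zero hr u) (volume_cube_ne_top hr u)]⟩

theorem ae_avgMeasure_of_ae {q : Cn n → Prop} (h : ∀ᵐ z, q z) (r : ℝ) (u : Cn n) :
    ∀ᵐ z ∂(avgMeasure r u), q z :=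
  Measure.ae_smul_measure (ae_restrict_of_ae h) _

theorem aestronglyMeasurable_avgMeasure {E : Type*} [TopologicalSpace E] {f : Cn n → E}
    (h : AEStronglyMeasurable f volume) (r : ℝ) (u : Cn n) :
    AEStronglyMeasurable f (avgMeasure r u) :=
  h.restrict.smul_measure _

theorem avgMeasure_half_le (hr : 0 < r)
    (h : ∀ j, |(u j - v j).re| ≤ r / 2 ∧ |(u j - v j).im| ≤ r / 2) :
    avgMeasure (r / 2) (fun j => (u j + v j) / 2) ≤ (4 : ℝ≥0∞) ^ n • avgMeasure r u := by
  have hv : (volume (cube (r / 2) fun j => (u j + v j) / 2))⁻¹ = 4 ^ n * (volume (cube r u))⁻¹ := by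
    rw [volume_cube (half_pos hr), volume_cube hr, ← ENNReal.ofReal_inv_of_pos (by positivity),
      ← ENNReal.ofReal_inv_of_pos (by positivity),
      show (4 : ℝ≥0∞) ^ n = ENNReal.ofReal (4 ^ n) by
        rw [ENNReal.ofReal_pow (by norm_num)]; norm_num,
      ← ENNReal.ofReal_mul (by positivity)]
    congr 1
    rw [div_pow, div_pow]
    norm_num
    rw [div_eq_mul_inv]
  rw [avgMeasure, avgMeasure, hv, smul_smul]
  gcongr
  exact cube_half_midpoint_subset h

end Cubes

/-! ### Averaged norms and the `A_{p,r}` condition -/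

section Averages

variable {n d : ℕ} {p r : ℝ} {W : Cn n → Matrix (Fin d) (Fin d) ℂ} {u v : Cn n}

/-- The average `ρ_{p,Q}` of the metric of `W` over a cube. -/
def primalAvg (p r : ℝ) (W : Cn n → Matrix (Fin d) (Fin d) ℂ) (u : Cn n) (y : Cd d) : ℝ≥0∞ :=
  eLpNorm (fun z => mpow (W z) (1 / p) y) (ENNReal.ofReal p) (avgMeasure r u)

/-- The average `ρ*_{p',Q}` of the dual metric of `W` over a cube. -/
def dualAvg (p r : ℝ) (W : Cn n → Matrix (Fin d) (Fin d) ℂ) (u : Cn n) (x : Cd d) : ℝ≥0∞ :=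
  eLpNorm (fun z => mpow (W z) (-(1 / p)) x) (ENNReal.ofReal p).conjExponent (avgMeasure r u)

theorem avgNorm_weightMetric (p r : ℝ) (W : Cn n → Matrix (Fin d) (Fin d) ℂ) (u : Cn n) :
    avgNorm (weightMetric p W) (ENNReal.ofReal p) (cube r u) = primalAvg p r W u := by
  ext y
  exact eLpNorm_enorm _

theorem avgNorm_dualNorm_weightMetric (hW : IsMatrixWeight W) (p r : ℝ) (u : Cn n) :
    avgNorm (fun z => dualNorm (weightMetric p W z)) (ENNReal.ofReal p).conjExponent (cube r u)
      = dualAvg p r W u := by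
  ext x
  refine eLpNorm_congr_enorm_ae ?_
  filter_upwards [ae_avgMeasure_of_ae hW.posDef r u] with z hz
  rw [enorm_eq_self]
  exact dualNorm_mpow hz _ _

theorem aprBound_iff (hW : IsMatrixWeight W) {C : ℝ≥0} :
    AprBound p r (weightMetric p W) C ↔
      ∀ x u, dualAvg p r W u x ≤ C * dualNorm (primalAvg p r W u) x := by
  simp only [AprBound, avgNorm_weightMetric, avgNorm_dualNorm_weightMetric hW]

theorem aestronglyMeasurable_mpow_weight (hW : IsMatrixWeight W) (s : ℝ) :
    AEStronglyMeasurable (fun z => mpow (W z) s) volume :=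
  aestronglyMeasurable_mpow (fun i j => (hW.locallyIntegrable i j).aestronglyMeasurable)
    hW.posDef s

theorem aestronglyMeasurable_mpow_apply (hW : IsMatrixWeight W) (s : ℝ) {f : Cn n → Cd d}
    (hf : AEStronglyMeasurable f volume) :
    AEStronglyMeasurable (fun z => mpow (W z) s (f z)) volume :=
  isBoundedBilinearMap_apply.continuous.comp_aestronglyMeasurable
    ((aestronglyMeasurable_mpow_weight hW s).prodMk hf)

/-- The function `⟨W^{-1/p}(z)x, W^{1/p}(z)y⟩` is almost everywhere the constant `⟨x, y⟩`; its
average is estimated by Hölder's inequality. -/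
theorem enorm_inner_le_primalAvg_mul_dualAvg (hW : IsMatrixWeight W) (hp : 1 ≤ p) (hr : 0 < r)
    (u : Cn n) (x y : Cd d) : ‖inner ℂ x y‖ₑ ≤ primalAvg p r W u y * dualAvg p r W u x := by
  have := isProbabilityMeasure_avgMeasure hr u
  have hpq := ENNReal.HolderConjugate.conjExponent (p := ENNReal.ofReal p) (by simpa using hp)
  have hm : ∀ s (x : Cd d), AEStronglyMeasurable (fun z => mpow (W z) s x) (avgMeasure r u) :=
    fun s x => aestronglyMeasurable_avgMeasure
      (aestronglyMeasurable_mpow_apply hW s aestronglyMeasurable_const) r u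
  have h := eLpNorm_le_eLpNorm_mul_eLpNorm_of_nnnorm (hm (1 / p) y) (hm (-(1 / p)) x)
    (fun a b => inner ℂ b a) 1 (r := 1) (p := ENNReal.ofReal p)
    (q := (ENNReal.ofReal p).conjExponent)
    (Filter.Eventually.of_forall fun z => by
      rw [one_mul, mul_comm]; exact nnnorm_inner_le_nnnorm _ _)
  rw [ENNReal.coe_one, one_mul] at h
  refine le_trans (le_of_eq ?_) h
  have hc : eLpNorm (fun z => (inner ℂ (mpow (W z) (-(1 / p)) x) (mpow (W z) (1 / p) y) : ℂ)) 1
      (avgMeasure r u) = eLpNorm (fun _ => (inner ℂ x y : ℂ)) 1 (avgMeasure r u) := by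
    refine eLpNorm_congr_ae ?_
    filter_upwards [ae_avgMeasure_of_ae hW.posDef r u] with z hz
    rw [inner_mpow, mpow_neg_mpow hz]
  rw [hc, eLpNorm_const _ one_ne_zero (IsProbabilityMeasure.ne_zero _)]
  simp

theorem dualNorm_primalAvg_le (hW : IsMatrixWeight W) (hp : 1 ≤ p) (hr : 0 < r)
    (u : Cn n) (x : Cd d) : dualNorm (primalAvg p r W u) x ≤ dualAvg p r W u x :=
  iSup₂_le fun y _ => ENNReal.div_le_of_le_mul <| by
    rw [mul_comm]; exact enorm_inner_le_primalAvg_mul_dualAvg hW hp hr u x y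

theorem dualNorm_mono {N N' : Cd d → ℝ≥0∞} {c : ℝ≥0∞} (hc : c ≠ 0) (hc' : c ≠ ∞)
    (h : ∀ y, N y ≤ c * N' y) (x : Cd d) : dualNorm N' x ≤ c * dualNorm N x := by
  refine iSup₂_le fun y hy => ?_
  calc ‖inner ℂ x y‖ₑ / N' y = c * (‖inner ℂ x y‖ₑ / (c * N' y)) := by
        rw [← mul_div_assoc, ENNReal.mul_div_mul_left _ _ hc hc']
    _ ≤ c * (‖inner ℂ x y‖ₑ / N y) := by gcongr; exact h y
    _ ≤ _ := by
      gcongr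
      exact le_iSup₂ (f := fun (y : Cd d) (_ : y ≠ 0) => ‖inner ℂ x y‖ₑ / N y) y hy

/-- The volumes differ by `2^{2n} = 4^n`, and `(4^n)^{1/q} ≤ 4^n` makes the bound uniform in `q`,
including `q = ∞`. -/
theorem eLpNorm_avgMeasure_half_le {E : Type*} [NormedAddCommGroup E] (hr : 0 < r)
    (h : ∀ j, |(u j - v j).re| ≤ r / 2 ∧ |(u j - v j).im| ≤ r / 2) {q : ℝ≥0∞} (hq : 1 ≤ q)
    (f : Cn n → E) :
    eLpNorm f q (avgMeasure (r / 2) (fun j => (u j + v j) / 2))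
      ≤ 4 ^ n * eLpNorm f q (avgMeasure r u) := by
  refine (eLpNorm_mono_measure f (avgMeasure_half_le hr h)).trans ?_
  have h4 : (1 : ℝ≥0∞) ≤ 4 ^ n := one_le_pow₀ (by norm_num)
  rw [eLpNorm_smul_measure_of_ne_zero (by positivity), smul_eq_mul]
  gcongr
  refine (ENNReal.rpow_le_rpow_of_exponent_le h4 ?_).trans_eq (ENNReal.rpow_one _)
  rw [one_div]
  exact ENNReal.toReal_mono ENNReal.one_ne_top (ENNReal.inv_le_one.2 hq)

/-- Through the half-size cube at the midpoint: duality reverses the comparison of `ρ_{p,Q}` with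
the cube at `v`, Hölder passes to the average of the dual metric, which is compared with the cube at
`u`, and there the `A_{p,r}` condition leads back. Each comparison costs `4^n`, and the condition is
used only at side `r`. -/
theorem dualNorm_primalAvg_le_of_near (hW : IsMatrixWeight W) (hp : 1 ≤ p) (hr : 0 < r) {C : ℝ≥0}
    (hC : AprBound p r (weightMetric p W) C)
    (h : ∀ j, |(u j - v j).re| ≤ r / 2 ∧ |(u j - v j).im| ≤ r / 2) (x : Cd d) :
    dualNorm (primalAvg p r W v) x ≤ 16 ^ n * C * dualNorm (primalAvg p r W u) x := by
  have hpq := ENNReal.HolderConjugate.conjExponent (p := ENNReal.ofReal p) (by simpa using hp)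
  have h' : ∀ j, |(v j - u j).re| ≤ r / 2 ∧ |(v j - u j).im| ≤ r / 2 := fun j => by
    rw [← neg_sub, Complex.neg_re, Complex.neg_im, abs_neg, abs_neg]; exact h j
  have hmid : (fun j => (v j + u j) / 2) = fun j => (u j + v j) / 2 := by
    ext j; rw [add_comm]
  have h1 := dualNorm_mono (c := 4 ^ n) (by positivity) (by simp)
    (fun y => eLpNorm_avgMeasure_half_le hr h' (q := ENNReal.ofReal p) (by simpa using hp)
      (fun z => mpow (W z) (1 / p) y)) x
  rw [hmid] at h1
  calc dualNorm (primalAvg p r W v) x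
      ≤ 4 ^ n * dualNorm (primalAvg p (r / 2) W fun j => (u j + v j) / 2) x := h1
    _ ≤ 4 ^ n * dualAvg p (r / 2) W (fun j => (u j + v j) / 2) x := by
        gcongr; exact dualNorm_primalAvg_le hW hp (half_pos hr) _ _
    _ ≤ 4 ^ n * (4 ^ n * dualAvg p r W u x) := by
        gcongr
        exact eLpNorm_avgMeasure_half_le hr h (ENNReal.HolderConjugate.one_le _ (ENNReal.ofReal p)) _
    _ ≤ 4 ^ n * (4 ^ n * (C * dualNorm (primalAvg p r W u) x)) := by
        gcongr; exact (aprBound_iff hW).1 hC x u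
    _ = _ := by
        rw [show (16 : ℝ≥0∞) = 4 * 4 by norm_num, mul_pow]; ring

theorem primalAvg_smul (u : Cn n) (c : ℂ) (y : Cd d) :
    primalAvg p r W u (c • y) = ‖c‖ₑ * primalAvg p r W u y := by
  rw [primalAvg, primalAvg, ← eLpNorm_const_smul]
  simp only [map_smul]
  rfl

/-- By the trace bound `|W^{1/p}y|^p ≤ |tr W| |y|^p`, local integrability of the entries suffices.
-/
theorem primalAvg_lt_top (hW : IsMatrixWeight W) (hp : 1 ≤ p) (hr : 0 < r) (u : Cn n) (y : Cd d) :
    primalAvg p r W u y < ∞ := by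
  have hp0 : 0 < p := one_pos.trans_le hp
  have hint : Integrable (fun z => (W z).trace) (avgMeasure r u) := by
    refine Integrable.smul_measure ?_ (by simpa using volume_cube_ne_zero hr u)
    simp only [Matrix.trace, Matrix.diag]
    exact integrable_finsetSum _ fun i _ =>
      (hW.locallyIntegrable i i).integrableOn_isCompact (isCompact_cube r u)
  rw [primalAvg, eLpNorm_eq_lintegral_rpow_enorm_toReal (by simpa using hp0) (by simp),
    ENNReal.toReal_ofReal hp0.le]
  refine ENNReal.rpow_lt_top_of_nonneg (by positivity) (ne_of_lt ?_)
  calc ∫⁻ z, ‖mpow (W z) (1 / p) y‖ₑ ^ p ∂(avgMeasure r u)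
      ≤ ∫⁻ z, ‖(W z).trace‖ₑ * ‖y‖ₑ ^ p ∂(avgMeasure r u) := by
        refine lintegral_mono_ae ?_
        filter_upwards [ae_avgMeasure_of_ae hW.posDef r u] with z hz
        have h1 : ‖mpow (W z) (1 / p) y‖ ≤ ‖(W z).trace‖ ^ (1 / p) * ‖y‖ := by
          refine ((mpow (W z) (1 / p)).le_opNorm y).trans ?_
          gcongr
          refine (norm_mpow_le hz (by positivity)).trans ?_
          have h0 : 0 ≤ (W z).trace.re := by
            rw [hz.1.trace_eq_sum_eigenvalues]
            simpa using Finset.sum_nonneg fun i _ => (hz.eigenvalues_pos i).le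
          gcongr
          exact Complex.re_le_norm _
        have h2 : ‖mpow (W z) (1 / p) y‖ₑ ≤ ‖(W z).trace‖ₑ ^ (1 / p) * ‖y‖ₑ := by
          rw [← ofReal_norm, ← ofReal_norm, ← ofReal_norm,
            ENNReal.ofReal_rpow_of_nonneg (norm_nonneg _) (by positivity),
            ← ENNReal.ofReal_mul (by positivity)]
          exact ENNReal.ofReal_le_ofReal h1
        calc _ ≤ (‖(W z).trace‖ₑ ^ (1 / p) * ‖y‖ₑ) ^ p := by gcongr
          _ = _ := by
            rw [ENNReal.mul_rpow_of_nonneg _ _ hp0.le, ← ENNReal.rpow_mul,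
              one_div_mul_cancel hp0.ne', ENNReal.rpow_one]
    _ = (∫⁻ z, ‖(W z).trace‖ₑ ∂(avgMeasure r u)) * ‖y‖ₑ ^ p := by
        rw [lintegral_mul_const'' _ hint.aestronglyMeasurable.enorm]
    _ < ∞ := ENNReal.mul_lt_top hint.2 (ENNReal.rpow_lt_top_of_nonneg hp0.le (by simp))

/-- The constant is the average of `‖W^{-1/p}‖⁻¹`. It is nonzero because an operator norm is finite,
and on a probability space the `L¹` norm is at most the `L^p` norm. -/
theorem exists_mul_le_primalAvg (hW : IsMatrixWeight W) (hp : 1 ≤ p) (hr : 0 < r) (u : Cn n) :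
    ∃ c : ℝ≥0∞, c ≠ 0 ∧ ∀ y, c * ‖y‖ₑ ≤ primalAvg p r W u y := by
  have := isProbabilityMeasure_avgMeasure hr u
  have hm : AEStronglyMeasurable (fun z => mpow (W z) (-(1 / p))) (avgMeasure r u) :=
    aestronglyMeasurable_avgMeasure (aestronglyMeasurable_mpow_weight hW _) r u
  have hmi : AEMeasurable (fun z => ‖mpow (W z) (-(1 / p))‖ₑ⁻¹) (avgMeasure r u) := hm.enorm.inv
  refine ⟨∫⁻ z, ‖mpow (W z) (-(1 / p))‖ₑ⁻¹ ∂(avgMeasure r u), fun h0 => ?_, fun y => ?_⟩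
  · rw [lintegral_eq_zero_iff' hmi] at h0
    obtain ⟨z, hz⟩ := h0.exists
    simp at hz
  · have hmy : AEStronglyMeasurable (fun z => mpow (W z) (1 / p) y) (avgMeasure r u) :=
      aestronglyMeasurable_avgMeasure
      (aestronglyMeasurable_mpow_apply hW _ aestronglyMeasurable_const) r u
    refine le_trans ?_ (eLpNorm_le_eLpNorm_of_exponent_le (p := 1) (by simpa using hp) hmy)
    rw [eLpNorm_one_eq_lintegral_enorm, ← lintegral_mul_const'' _ hmi]
    refine lintegral_mono_ae ?_
    filter_upwards [ae_avgMeasure_of_ae hW.posDef r u] with z hz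
    rw [mul_comm, ← div_eq_mul_inv]
    refine ENNReal.div_le_of_le_mul ?_
    rw [mul_comm]
    conv_lhs => rw [← mpow_neg_mpow hz (1 / p) y]
    exact (mpow (W z) (-(1 / p))).le_opENorm _

theorem dualNorm_primalAvg_lt_top (hW : IsMatrixWeight W) (hp : 1 ≤ p) (hr : 0 < r) (u : Cn n)
    (x : Cd d) : dualNorm (primalAvg p r W u) x < ∞ := by
  obtain ⟨c, hc, h⟩ := exists_mul_le_primalAvg hW hp hr u
  refine lt_of_le_of_lt (b := ‖x‖ₑ / c) (iSup₂_le fun y hy => ?_)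
    (ENNReal.div_lt_top (by simp) hc)
  have hy' : ‖y‖ₑ ≠ 0 := by simpa using hy
  calc _ ≤ ‖x‖ₑ * ‖y‖ₑ / (c * ‖y‖ₑ) := ENNReal.div_le_div (enorm_inner_le x y) (h y)
    _ = _ := ENNReal.mul_div_mul_right _ _ hy' (by simp)

theorem enorm_inner_le_dualNorm_mul {N : Cd d → ℝ≥0∞} {x y : Cd d} (hy : N y ≠ ∞)
    (h0 : N y = 0 → inner ℂ x y = 0) : ‖inner ℂ x y‖ₑ ≤ dualNorm N x * N y := by
  by_cases hN : N y = 0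
  · simp [h0 hN]
  rcases eq_or_ne y 0 with rfl | hy0
  · simp
  rw [← ENNReal.div_le_iff hN hy]
  exact le_iSup₂ (f := fun (y : Cd d) (_ : y ≠ 0) => ‖inner ℂ x y‖ₑ / N y) y hy0

theorem primalAvg_eq_zero (hW : IsMatrixWeight W) (hp : 1 ≤ p) (hr : 0 < r) (u : Cn n)
    {y : Cd d} (h : primalAvg p r W u y = 0) : y = 0 := by
  obtain ⟨c, hc, hcy⟩ := exists_mul_le_primalAvg hW hp hr u
  have := hcy y
  rw [h, nonpos_iff_eq_zero, mul_eq_zero] at this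
  simpa using this.resolve_left hc

theorem enorm_inner_le_dualNorm_primalAvg_mul (hW : IsMatrixWeight W) (hp : 1 ≤ p) (hr : 0 < r)
    (u : Cn n) (x y : Cd d) :
    ‖inner ℂ x y‖ₑ ≤ dualNorm (primalAvg p r W u) x * primalAvg p r W u y :=
  enorm_inner_le_dualNorm_mul (primalAvg_lt_top hW hp hr u y).ne fun h => by
    rw [primalAvg_eq_zero hW hp hr u h, inner_zero_right]

/-- Hölder gives the reverse of the `A_{p,r}` inequality with constant `1`; both sides are positive
and finite for a basis vector, which exists because `d > 0`. -/
theorem one_le_of_aprBound (hW : IsMatrixWeight W) (hd : 0 < d) (hp : 1 ≤ p) (hr : 0 < r)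
    {C : ℝ≥0} (hC : AprBound p r (weightMetric p W) C) : 1 ≤ C := by
  let x : Cd d := EuclideanSpace.single ⟨0, hd⟩ 1
  have hx : x ≠ 0 := by simp [x]
  set A := dualNorm (primalAvg p r W 0) x with hA
  have hA0 : A ≠ 0 := fun h => by
    have := enorm_inner_le_dualNorm_primalAvg_mul hW hp hr 0 x x
    rw [← hA, h, zero_mul, nonpos_iff_eq_zero, enorm_eq_zero, inner_self_eq_zero] at this
    exact hx this
  have hAt : A ≠ ∞ := (dualNorm_primalAvg_lt_top hW hp hr 0 x).ne
  have h : A ≤ C * A := (dualNorm_primalAvg_le hW hp hr 0 x).trans ((aprBound_iff hW).1 hC x 0)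
  have : (1 : ℝ≥0∞) ≤ C := by
    by_contra! hlt
    exact absurd h (not_le.2 (by simpa using ENNReal.mul_lt_mul_left hA0 hAt hlt))
  exact_mod_cast this

/-- The `A_{p,r}`-constant is attained. -/
theorem aprBound_toNNReal_aprConst (hW : IsMatrixWeight W) (hp : 1 ≤ p) (hr : 0 < r)
    (h : IsAprWeight p r W) : AprBound p r (weightMetric p W) (aprConst p r W).toNNReal := by
  obtain ⟨C, -, hC⟩ := h
  have hlt : aprConst p r W ≠ ∞ := ne_top_of_le_ne_top ENNReal.coe_ne_top (iInf₂_le C hC)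
  rw [aprBound_iff hW]
  intro x u
  have hA := (dualNorm_primalAvg_lt_top hW hp hr u x).ne
  rw [ENNReal.coe_toNNReal hlt]
  by_cases hA0 : dualNorm (primalAvg p r W u) x = 0
  · exact ((aprBound_iff hW).1 hC x u).trans (by simp [hA0])
  rw [← ENNReal.div_le_iff hA0 hA]
  exact le_iInf₂ fun C' hC' => ENNReal.div_le_of_le_mul ((aprBound_iff hW).1 hC' x u)

end Averages

/-! ### The converse of Hölder's inequality -/

section Duality

variable {Ω : Type*} [MeasurableSpace Ω] {μ : Measure Ω}

theorem conjExponent_ofReal_of_one_lt {p : ℝ} (hp : 1 < p) :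
    (ENNReal.ofReal p).conjExponent = ENNReal.ofReal (p / (p - 1)) := by
  have h : ENNReal.ofReal p = (p.toNNReal : ℝ≥0∞) := rfl
  rw [h, ← ENNReal.coe_conjExponent (by
    rwa [← NNReal.coe_lt_coe, Real.coe_toNNReal _ (by linarith)])]
  have hp1 : 1 ≤ p.toNNReal := by
    rw [← NNReal.coe_le_coe, Real.coe_toNNReal _ (by linarith)]; exact hp.le
  have h1 : (p.toNNReal : ℝ≥0).conjExponent = (p / (p - 1)).toNNReal := by
    rw [← NNReal.coe_inj, NNReal.conjExponent, NNReal.coe_div, NNReal.coe_sub hp1,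
      Real.coe_toNNReal _ (by linarith),
      Real.coe_toNNReal _ (div_nonneg (by linarith) (by linarith)), NNReal.coe_one]
  rw [h1]; rfl

/-- A function whose pairings with all of `L^p` are bounded is in `L^{p'}`. -/
theorem eLpNorm_conjExponent_le [IsFiniteMeasure μ] {p : ℝ} (hp : 1 ≤ p) {w : Ω → ℝ≥0}
    (hw : AEMeasurable w μ) {c : ℝ≥0∞}
    (h : ∀ g : Ω → ℝ≥0, AEMeasurable g μ →
      eLpNorm (fun z => (g z : ℝ≥0∞)) (ENNReal.ofReal p) μ < ∞ →
      ∫⁻ z, g z * w z ∂μ ≤ c * eLpNorm (fun z => (g z : ℝ≥0∞)) (ENNReal.ofReal p) μ) :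
    eLpNorm (fun z => (w z : ℝ≥0∞)) (ENNReal.ofReal p).conjExponent μ ≤ c := by
  have hp0 : 0 < p := one_pos.trans_le hp
  have hnorm : ∀ g : Ω → ℝ≥0∞, eLpNorm g (ENNReal.ofReal p) μ = (∫⁻ z, g z ^ p ∂μ) ^ (1 / p) :=
    fun g => by
      rw [eLpNorm_eq_lintegral_rpow_enorm_toReal (by simpa using hp0) (by simp),
        ENNReal.toReal_ofReal hp0.le]
      simp
  rcases eq_or_ne c ∞ with rfl | hc
  · exact le_top
  rcases hp.eq_or_lt with rfl | hp1
  -- For `p = 1`, testing with indicators bounds the integral of `w` over each set by `c` times its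
  -- measure, hence the essential supremum.
  · have hq : (ENNReal.ofReal 1).conjExponent = ∞ := by simp [ENNReal.conjExponent]
    rw [hq, eLpNorm_exponent_top]
    refine essSup_le_of_ae_le _ ?_
    refine ae_le_of_forall_setLIntegral_le_of_sigmaFinite₀ (μ := μ)
      (by simpa using hw.coe_nnreal_ennreal) fun s hs hμs => ?_
    have key := h (s.indicator fun _ => 1) (aemeasurable_const.indicator hs) (by
      rw [hnorm]
      simp only [ENNReal.rpow_one, div_one]
      refine lt_of_le_of_lt (lintegral_mono (g := fun _ => 1) fun z => ?_) (by simp)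
      by_cases hz : z ∈ s <;> simp [hz])
    rw [hnorm] at key
    simp only [ENNReal.rpow_one, div_one] at key
    have e1 : ∀ z, ((s.indicator (fun _ => (1 : ℝ≥0)) z : ℝ≥0) : ℝ≥0∞)
        = s.indicator (fun _ => (1 : ℝ≥0∞)) z := fun z => by
      by_cases hz : z ∈ s <;> simp [hz]
    have e2 : ∀ z, ((s.indicator (fun _ => (1 : ℝ≥0)) z : ℝ≥0) : ℝ≥0∞) * w z
        = s.indicator (fun z => (w z : ℝ≥0∞)) z := fun z => by
      by_cases hz : z ∈ s <;> simp [hz]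
    simp only [e2] at key
    simp only [e1, lintegral_indicator hs, lintegral_const, one_mul] at key
    simpa using key
  · set q := p / (p - 1) with hq
    have hq0 : 0 < q := div_pos hp0 (by linarith)
    have hqp : (q - 1) * p = q := by rw [hq]; field_simp; ring
    rw [conjExponent_ofReal_of_one_lt hp1, eLpNorm_eq_lintegral_rpow_enorm_toReal
      (by simpa using hq0) (by simp), ENNReal.toReal_ofReal hq0.le]
    simp only [enorm_eq_self]
    set w' := hw.mk w with hw'
    have hww' : w =ᵐ[μ] w' := hw.ae_eq_mk
    have hm' : Measurable w' := hw.measurable_mk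
    rw [lintegral_congr_ae (g := fun z => (w' z : ℝ≥0∞) ^ q)
      (by filter_upwards [hww'] with z hz; rw [hz])]
    have hms : ∀ k : ℕ, MeasurableSet {z | w' z ≤ k} := fun k => hm' measurableSet_Iic
    -- The extremal test function is `w^{q-1}`, for which `(w^{q-1})^p = w^{q-1} w = w^q`.
    -- Truncation to `{w ≤ k}` makes the integral finite, so that one may divide by a power of it;
    -- then `k → ∞` by monotone convergence.
    have hI : ∀ k : ℕ, ∫⁻ z in {z | w' z ≤ k}, (w' z : ℝ≥0∞) ^ q ∂μ ≤ c ^ q := by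
      intro k
      set I := ∫⁻ z in {z | w' z ≤ k}, (w' z : ℝ≥0∞) ^ q ∂μ with hI
      have hIt : I ≠ ∞ := by
        refine ne_of_lt (lt_of_le_of_lt (b := ∫⁻ _ in {z | w' z ≤ k}, (k : ℝ≥0∞) ^ q ∂μ)
          (setLIntegral_mono measurable_const fun z hz => ?_) ?_)
        · have : (w' z : ℝ≥0∞) ≤ k := by exact_mod_cast hz
          gcongr
        · rw [lintegral_const]
          exact ENNReal.mul_lt_top (ENNReal.rpow_lt_top_of_nonneg hq0.le (by simp))
            (measure_lt_top _ _)
      let g : Ω → ℝ≥0 := {z | w' z ≤ k}.indicator fun z => w' z ^ (q - 1)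
      have hgp : ∫⁻ z, (g z : ℝ≥0∞) ^ p ∂μ = I := by
        rw [hI, ← lintegral_indicator (hms k)]
        refine lintegral_congr fun z => ?_
        by_cases hz : z ∈ {z | w' z ≤ k}
        · simp only [g, Set.indicator_of_mem hz]
          rw [ENNReal.coe_rpow_of_nonneg _ (by
            rw [← hqp] at hq0; exact (pos_of_mul_pos_left hq0 hp0.le).le), ← ENNReal.rpow_mul, hqp]
        · simp [g, Set.indicator_of_notMem hz, hp0]
      have hgw : ∫⁻ z, g z * w z ∂μ = I := by
        rw [hI, ← lintegral_indicator (hms k)]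
        refine lintegral_congr_ae ?_
        filter_upwards [hww'] with z hzz
        by_cases hz : z ∈ {z | w' z ≤ k}
        · simp only [g, Set.indicator_of_mem hz, hzz]
          have hq1 : 0 ≤ q - 1 := by
            rw [← hqp] at hq0; exact (pos_of_mul_pos_left hq0 hp0.le).le
          rw [ENNReal.coe_rpow_of_nonneg _ hq1]
          conv_lhs => rw [← ENNReal.rpow_one (w' z : ℝ≥0∞), ← ENNReal.rpow_mul, one_mul]
          rw [← ENNReal.rpow_add_of_nonneg _ _ hq1 zero_le_one, sub_add_cancel]
        · simp [g, Set.indicator_of_notMem hz]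
      have key := h g ((hm'.pow_const _).indicator (hms k)).aemeasurable (by
        rw [hnorm, hgp]; exact ENNReal.rpow_lt_top_of_nonneg (by positivity) hIt)
      rw [hnorm, hgp, hgw] at key
      rcases eq_or_ne I 0 with h0 | h0
      · rw [h0]; exact zero_le
      have hpq : 1 / p + 1 / q = 1 := by rw [hq]; field_simp; ring
      have h2 : I ^ (1 / q) ≤ c := by
        have h3 : I = I ^ (1 / q) * I ^ (1 / p) := by
          rw [← ENNReal.rpow_add _ _ h0 hIt, add_comm, hpq, ENNReal.rpow_one]
        have h4 : I ^ (1 / p) ≠ 0 := by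
          simp [h0, hIt]
        have h5 : I ^ (1 / p) ≠ ∞ := (ENNReal.rpow_lt_top_of_nonneg (by positivity) hIt).ne
        calc I ^ (1 / q) = I ^ (1 / q) * I ^ (1 / p) / I ^ (1 / p) :=
              (ENNReal.mul_div_cancel_right h4 h5).symm
          _ = I / I ^ (1 / p) := by rw [← h3]
          _ ≤ c := ENNReal.div_le_of_le_mul key
      calc I = (I ^ (1 / q)) ^ q := by
            rw [← ENNReal.rpow_mul, one_div_mul_cancel hq0.ne', ENNReal.rpow_one]
        _ ≤ c ^ q := by gcongr
    have hU : (⋃ k : ℕ, {z | w' z ≤ k}) = Set.univ := by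
      ext z
      simp only [Set.mem_iUnion, Set.mem_univ, iff_true]
      exact exists_nat_ge (w' z)
    have hdir : Directed (fun x1 x2 => x1 ⊆ x2) fun k : ℕ => {z | w' z ≤ k} :=
      directed_of_isDirected_le fun a b hab z (hz : w' z ≤ a) =>
        show w' z ≤ b from hz.trans (by exact_mod_cast hab)
    rw [← setLIntegral_univ, ← hU, setLIntegral_iUnion_of_directed _ hdir]
    calc _ ≤ (c ^ q) ^ (1 / q) := by gcongr; exact iSup_le hI
      _ = c := by rw [← ENNReal.rpow_mul, mul_one_div_cancel hq0.ne', ENNReal.rpow_one]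

end Duality

/-! ### The Gaussian measure, the kernel and the weighted norm -/

section Gaussian

variable {n d : ℕ} {α p r : ℝ}

theorem continuous_sqNorm : Continuous (sqNorm (n := n)) := by
  unfold sqNorm; fun_prop

theorem continuous_kernel : Continuous fun q : Cn n × Cn n => kernel α q.1 q.2 := by
  unfold kernel herm; fun_prop

theorem sqNorm_sub (z u : Cn n) : sqNorm (z - u) = sqNorm z - 2 * (herm z u).re + sqNorm u := by
  simp only [sqNorm, herm, Complex.re_sum, Finset.mul_sum, ← Finset.sum_sub_distrib,
    ← Finset.sum_add_distrib, ← Complex.normSq_eq_norm_sq, Pi.sub_apply, Complex.normSq_sub]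
  refine Finset.sum_congr rfl fun j _ => ?_
  ring

theorem herm_sub_left (u v z : Cn n) : herm (u - v) z = herm u z - herm v z := by
  simp [herm, sub_mul, Finset.sum_sub_distrib]

theorem herm_sub_right (u v z : Cn n) : herm z (u - v) = herm z u - herm z v := by
  simp [herm, mul_sub, Finset.sum_sub_distrib]

theorem conj_herm (u z : Cn n) : conj (herm u z) = herm z u := by
  simp [herm, mul_comm]

theorem herm_self (z : Cn n) : herm z z = sqNorm z := by
  simp only [herm, sqNorm, Complex.ofReal_sum]
  refine Finset.sum_congr rfl fun j _ => ?_
  rw [Complex.mul_conj, Complex.normSq_eq_norm_sq]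

theorem conj_kernel (α : ℝ) (z u : Cn n) : conj (kernel α z u) = Complex.exp (α * herm z u) := by
  rw [kernel, ← Complex.exp_conj, map_mul, Complex.conj_ofReal, conj_herm]

theorem norm_kernel (α : ℝ) (z u : Cn n) : ‖kernel α z u‖ = Real.exp (α * (herm z u).re) := by
  rw [← RCLike.norm_conj, conj_kernel, Complex.norm_exp, Complex.re_ofReal_mul]

theorem norm_herm_le {z u : Cn n} {R : ℝ} (hz : ∀ j, ‖z j‖ ≤ R) (hu : ∀ j, ‖u j‖ ≤ R) :
    ‖herm z u‖ ≤ n * R ^ 2 := by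
  calc ‖herm z u‖ ≤ ∑ j, ‖z j * conj (u j)‖ := norm_sum_le _ _
    _ ≤ ∑ _j : Fin n, R ^ 2 := Finset.sum_le_sum fun j _ => by
        rw [norm_mul, RCLike.norm_conj, sq]
        exact mul_le_mul (hz j) (hu j) (norm_nonneg _) ((norm_nonneg _).trans (hz j))
    _ = n * R ^ 2 := by simp

theorem norm_sub_le_of_mem_cube {z u : Cn n} (hz : z ∈ cube r u) (j : Fin n) :
    ‖(z - u) j‖ ≤ √(r ^ 2 / 2) := by
  refine Real.le_sqrt_of_sq_le ?_
  rw [← Complex.normSq_eq_norm_sq, Complex.normSq_apply]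
  have h1 := sq_le_sq' (abs_le.1 (hz j).1).1 (abs_le.1 (hz j).1).2
  have h2 := sq_le_sq' (abs_le.1 (hz j).2).1 (abs_le.1 (hz j).2).2
  simp only [Pi.sub_apply]
  nlinarith

/-- The density of the Gaussian measure. -/
def gaussianDensity (n : ℕ) (α : ℝ) (u : Cn n) : ℝ :=
  (α / Real.pi) ^ n * Real.exp (-α * sqNorm u)

theorem continuous_gaussianDensity : Continuous (gaussianDensity n α) := by
  have := continuous_sqNorm (n := n)
  unfold gaussianDensity; fun_prop

theorem gaussianDensity_pos (hα : 0 < α) (u : Cn n) : 0 < gaussianDensity n α u := by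
  have := Real.pi_pos
  unfold gaussianDensity; positivity

theorem measurable_ofReal_gaussianDensity :
    Measurable fun u : Cn n => ENNReal.ofReal (gaussianDensity n α u) :=
  continuous_gaussianDensity.measurable.ennreal_ofReal

theorem integral_gaussian {E : Type*} [NormedAddCommGroup E] [NormedSpace ℝ E] (hα : 0 < α)
    (f : Cn n → E) : ∫ u, f u ∂(gaussian n α) = ∫ u, gaussianDensity n α u • f u := by
  refine (integral_withDensity_eq_integral_toReal_smul measurable_ofReal_gaussianDensity
    (Filter.Eventually.of_forall fun _ => ENNReal.ofReal_lt_top) f).trans ?_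
  simp only [ENNReal.toReal_ofReal (gaussianDensity_pos hα _).le]

theorem integrable_gaussian {E : Type*} [NormedAddCommGroup E] [NormedSpace ℝ E] (hα : 0 < α)
    {f : Cn n → E} : Integrable f (gaussian n α) ↔
      Integrable (fun u => gaussianDensity n α u • f u) volume := by
  refine (integrable_withDensity_iff_integrable_smul' measurable_ofReal_gaussianDensity
    (Filter.Eventually.of_forall fun _ => ENNReal.ofReal_lt_top)).trans ?_
  simp only [ENNReal.toReal_ofReal (gaussianDensity_pos hα _).le]

theorem lintegral_gaussian (f : Cn n → ℝ≥0∞) :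
    ∫⁻ u, f u ∂(gaussian n α) = ∫⁻ u, ENNReal.ofReal (gaussianDensity n α u) * f u :=
  lintegral_withDensity_eq_lintegral_mul_non_measurable _ measurable_ofReal_gaussianDensity
    (Filter.Eventually.of_forall fun _ => ENNReal.ofReal_lt_top) f

theorem gaussian_absolutelyContinuous : gaussian n α ≪ volume :=
  withDensity_absolutelyContinuous _ _

theorem lpNorm_eq_eLpNorm (hp : 0 < p) (g : Cn n → ℝ≥0∞) :
    lpNorm α p g = eLpNorm (fun z => g z * ENNReal.ofReal (Real.exp (-(α / 2) * sqNorm z)))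
      (ENNReal.ofReal p) volume := by
  rw [eLpNorm_eq_lintegral_rpow_enorm_toReal (by simpa using hp) (by simp),
    ENNReal.toReal_ofReal hp.le, lpNorm]
  congr 1
  refine lintegral_congr fun z => ?_
  rw [enorm_eq_self, ENNReal.mul_rpow_of_nonneg _ _ hp.le,
    ENNReal.ofReal_rpow_of_pos (Real.exp_pos _), ← Real.exp_mul]
  congr 3
  ring

end Gaussian

/-! ### Undoing the kernel on a cube: boundedness of averages -/

section TestFunctions

open Filter Topology

variable {n d m : ℕ} {α p r : ℝ} {W : Cn n → Matrix (Fin d) (Fin d) ℂ} {a : Cn n}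
  {g : Cn n → Cd d} {C : ℝ≥0}

/-- The monomial on `ℂⁿ` with the factors `z_{φ 0}, z_{φ 1}, …`. -/
def monomial (φ : Fin m → Fin n) (w : Cn n) : ℂ := ∏ l, w (φ l)

theorem continuous_monomial (φ : Fin m → Fin n) : Continuous (monomial φ) := by
  unfold monomial; fun_prop

/-- Separates the variables in a power of the Hermitian form. Indexing by words `φ` instead of
multi-indices avoids multinomial coefficients. -/
theorem sum_monomial_mul_conj (m : ℕ) (w v : Cn n) :
    ∑ φ : Fin m → Fin n, monomial φ w * conj (monomial φ v) = herm w v ^ m := by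
  simp only [herm, Fintype.sum_pow, monomial, map_prod, Finset.prod_mul_distrib]

theorem norm_monomial_le {R : ℝ} {w : Cn n} (hw : ∀ j, ‖w j‖ ≤ R) (φ : Fin m → Fin n) :
    ‖monomial φ w‖ ≤ R ^ m := by
  rw [monomial, norm_prod]
  exact (Finset.prod_le_prod (fun _ _ => norm_nonneg _) fun l _ => hw (φ l)).trans_eq (by simp)

theorem sqNorm_sub_comm (z u : Cn n) : sqNorm (z - u) = sqNorm (u - z) := by
  simp [sqNorm, norm_sub_rev]

/-- The factor by which functions supported on a cube with centre `a` are multiplied before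
applying `P_α`. -/
def preFactor (α : ℝ) (a : Cn n) (φ : Fin m → Fin n) (u : Cn n) : ℂ :=
  Complex.exp (α * herm u u - α * herm a u) * conj (monomial φ (u - a))

/-- The factor by which the result is multiplied after applying `P_α`. -/
def postFactor (α : ℝ) (a : Cn n) (φ : Fin m → Fin n) (z : Cn n) : ℂ :=
  Complex.exp (-(α * herm (z - a) a)) * monomial φ (z - a)

/-- The test function obtained by cutting off to a cube with centre `a`. -/
def testFun (α r : ℝ) (a : Cn n) (g : Cn n → Cd d) (φ : Fin m → Fin n) : Cn n → Cd d :=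
  (cube r a).indicator fun u => preFactor α a φ u • g u

theorem continuous_preFactor (φ : Fin m → Fin n) : Continuous (preFactor α a φ) := by
  have := continuous_monomial φ
  unfold preFactor herm; fun_prop

theorem continuous_postFactor (φ : Fin m → Fin n) : Continuous (postFactor α a φ) := by
  have := continuous_monomial φ
  unfold postFactor herm; fun_prop

/-- The exponent is `α|u|² - α Re⟨a,u⟩ - (α/2)|u|² = (α/2)|u-a|² - (α/2)|a|²`, and `|u-a|² ≤ nr²/2`
on the cube. The factor in `a` cancels against that of `norm_postFactor_le`. -/
theorem norm_preFactor_mul_le (hα : 0 < α) (φ : Fin m → Fin n) {u : Cn n} (hu : u ∈ cube r a) :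
    ‖preFactor α a φ u‖ * Real.exp (-(α / 2) * sqNorm u) ≤
      √(r ^ 2 / 2) ^ m * Real.exp (α * (n * r ^ 2 / 4) - α / 2 * sqNorm a) := by
  have h1 : ‖Complex.exp (α * herm u u - α * herm a u)‖
      = Real.exp (α * sqNorm u - α * (herm a u).re) := by
    rw [Complex.norm_exp, Complex.sub_re, Complex.re_ofReal_mul, Complex.re_ofReal_mul, herm_self,
      Complex.ofReal_re]
  rw [preFactor, norm_mul, h1, RCLike.norm_conj, mul_right_comm, ← Real.exp_add, mul_comm]
  refine mul_le_mul (norm_monomial_le (norm_sub_le_of_mem_cube hu) φ) (Real.exp_le_exp.2 ?_)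
    (Real.exp_pos _).le (by positivity)
  have h2 := sqNorm_sub a u
  have h3 := sqNorm_sub_le_of_mem_cube hu
  rw [sqNorm_sub_comm] at h2
  nlinarith

/-- Here `α|a|² - α Re⟨z,a⟩ = (α/2)|z-a|² + (α/2)|a|² - (α/2)|z|²`. -/
theorem norm_postFactor_le (hα : 0 < α) (φ : Fin m → Fin n) {z : Cn n} (hz : z ∈ cube r a) :
    ‖postFactor α a φ z‖ ≤ √(r ^ 2 / 2) ^ m *
      Real.exp (α * (n * r ^ 2 / 4) + α / 2 * sqNorm a) * Real.exp (-(α / 2) * sqNorm z) := by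
  have h1 : ‖Complex.exp (-(α * herm (z - a) a))‖
      = Real.exp (-(α * ((herm z a).re - sqNorm a))) := by
    rw [Complex.norm_exp, Complex.neg_re, Complex.re_ofReal_mul, herm_sub_left, herm_self,
      Complex.sub_re, Complex.ofReal_re]
  rw [postFactor, norm_mul, h1, mul_assoc, ← Real.exp_add, mul_comm]
  refine mul_le_mul (norm_monomial_le (norm_sub_le_of_mem_cube hz) φ) (Real.exp_le_exp.2 ?_)
    (Real.exp_pos _).le (by positivity)
  have h2 := sqNorm_sub z a
  have h3 := sqNorm_sub_le_of_mem_cube hz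
  nlinarith

theorem aestronglyMeasurable_testFun (hg : AEStronglyMeasurable g volume) (φ : Fin m → Fin n) :
    AEStronglyMeasurable (testFun α r a g φ) volume :=
  ((continuous_preFactor φ).aestronglyMeasurable.smul hg).indicator (measurableSet_cube r a)

theorem normLpW_testFun_le (hα : 0 < α) (hp : 0 < p) (φ : Fin m → Fin n) :
    normLpW α p W (testFun α r a g φ) ≤
      ENNReal.ofReal (√(r ^ 2 / 2) ^ m * Real.exp (α * (n * r ^ 2 / 4) - α / 2 * sqNorm a)) *
        eLpNorm (fun z => mpow (W z) (1 / p) (g z)) (ENNReal.ofReal p)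
          (volume.restrict (cube r a)) := by
  rw [normLpW, lpNorm_eq_eLpNorm hp, ← eLpNorm_indicator_eq_eLpNorm_restrict
    (measurableSet_cube r a)]
  refine eLpNorm_le_nnreal_smul_eLpNorm_of_ae_le_mul' (Eventually.of_forall fun z => ?_) _
  rw [enorm_eq_self, testFun]
  by_cases hz : z ∈ cube r a
  · rw [Set.indicator_of_mem hz, Set.indicator_of_mem hz, map_smul, enorm_smul, mul_right_comm]
    refine mul_le_mul_left ?_ _
    rw [← ofReal_norm, ← ENNReal.ofReal_mul (norm_nonneg _)]
    exact ENNReal.ofReal_le_ofReal (norm_preFactor_mul_le hα φ hz)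
  · simp [Set.indicator_of_notMem hz]

theorem eLpNorm_postFactor_smul_le (hα : 0 < α) (hp : 0 < p) (φ : Fin m → Fin n)
    (F : Cn n → Cd d) :
    eLpNorm (fun z => mpow (W z) (1 / p) (postFactor α a φ z • F z)) (ENNReal.ofReal p)
        (volume.restrict (cube r a)) ≤
      ENNReal.ofReal (√(r ^ 2 / 2) ^ m * Real.exp (α * (n * r ^ 2 / 4) + α / 2 * sqNorm a)) *
        normLpW α p W F := by
  rw [normLpW, lpNorm_eq_eLpNorm hp]
  refine le_trans (eLpNorm_le_nnreal_smul_eLpNorm_of_ae_le_mul'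
    (g := fun z => ‖mpow (W z) (1 / p) (F z)‖ₑ *
      ENNReal.ofReal (Real.exp (-(α / 2) * sqNorm z))) ?_ _)
    (mul_le_mul_right (eLpNorm_mono_measure _ Measure.restrict_le_self) _)
  filter_upwards [ae_restrict_mem (measurableSet_cube r a)] with z hz
  rw [enorm_eq_self, map_smul, enorm_smul, mul_left_comm, mul_comm]
  refine mul_le_mul_right ?_ _
  rw [← ofReal_norm]
  refine (ENNReal.ofReal_le_ofReal (norm_postFactor_le hα φ hz)).trans_eq ?_
  exact ENNReal.ofReal_mul (by positivity)

theorem gaussianDensity_smul_testFun (φ : Fin m → Fin n) (z u : Cn n) :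
    gaussianDensity n α u • conj (kernel α z u) • testFun α r a g φ u =
      (cube r a).indicator (fun u => ((α / Real.pi : ℝ) : ℂ) ^ n •
        (Complex.exp (α * herm (z - a) u) * conj (monomial φ (u - a))) • g u) u := by
  by_cases hu : u ∈ cube r a
  · rw [testFun, Set.indicator_of_mem hu, Set.indicator_of_mem hu, conj_kernel, preFactor,
      ← Complex.coe_smul, smul_smul, smul_smul, smul_smul, gaussianDensity, herm_self]
    congr 1
    push_cast
    simp only [← mul_assoc]
    congr 1
    rw [mul_assoc, mul_assoc, ← Complex.exp_add, ← Complex.exp_add, herm_sub_left]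
    congr 2
    ring
  · simp [testFun, Set.indicator_of_notMem hu]

/-- The factor before `P_α` removes the Gaussian density and shifts `z` to `z - a` in the kernel;
the one after it shifts `u` to `u - a`. -/
theorem postFactor_smul_fockProj (hα : 0 < α) (φ : Fin m → Fin n) (z : Cn n) :
    postFactor α a φ z • fockProj α (testFun α r a g φ) z =
      ((α / Real.pi : ℝ) : ℂ) ^ n • ∫ u in cube r a,
        (Complex.exp (α * herm (z - a) (u - a)) *
          (monomial φ (z - a) * conj (monomial φ (u - a)))) • g u := by
  rw [fockProj, integral_gaussian hα]
  simp only [gaussianDensity_smul_testFun]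
  rw [integral_indicator (measurableSet_cube r a), integral_smul, smul_comm, ← integral_smul]
  congr 1
  refine integral_congr_ae (Eventually.of_forall fun u => ?_)
  simp only [smul_smul, postFactor]
  congr 1
  rw [herm_sub_right u a (z - a), mul_sub (α : ℂ), sub_eq_add_neg (α * herm (z - a) u),
    Complex.exp_add]
  ring

/-- With no monomial and at the point `a`, the recentred kernel is identically `1`, so absolute
convergence of the projection there is integrability of `g`. -/
theorem integrableOn_of_testFun (hα : 0 < α)
    (h : Integrable (fun u => conj (kernel α a u) • testFun α r a g (Fin.elim0 : Fin 0 → Fin n) u)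
      (gaussian n α)) : IntegrableOn g (cube r a) volume := by
  rw [integrable_gaussian hα] at h
  simp only [gaussianDensity_smul_testFun] at h
  rw [integrable_indicator_iff (measurableSet_cube r a)] at h
  have h2 := Integrable.smul ((((α / Real.pi : ℝ) : ℂ) ^ n)⁻¹) h
  have hne : ((α / Real.pi : ℝ) : ℂ) ^ n ≠ 0 := by
    have := Real.pi_pos
    exact pow_ne_zero _ (Complex.ofReal_ne_zero.2 (by positivity))
  refine h2.congr (Eventually.of_forall fun u => ?_)
  have h0 : herm (a - a) u = 0 := by simp [herm]
  simp only [Pi.smul_apply, h0, monomial, Finset.univ_eq_empty, Finset.prod_empty, mul_zero,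
    Complex.exp_zero, map_one, mul_one, one_smul, smul_smul, inv_mul_cancel₀ hne]

theorem integrableOn_continuous_smul (hg : IntegrableOn g (cube r a) volume) {f : Cn n → ℂ}
    (hf : Continuous f) : IntegrableOn (fun u => f u • g u) (cube r a) volume :=
  hg.continuousOn_smul hf.continuousOn (isCompact_cube r a)

/-- The partial sums of the series which undoes the phase of the kernel on a cube. -/
def phaseSum (α r : ℝ) (a : Cn n) (g : Cn n → Cd d) (M : ℕ) (z : Cn n) : Cd d :=
  ∑ m ∈ Finset.range M, ((-α : ℂ) ^ m / m.factorial) •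
    ∑ φ : Fin m → Fin n, postFactor α a φ z • fockProj α (testFun α r a g φ) z

/-- Summing over words gives `⟨z-a, u-a⟩^m`, so the kernel becomes `e^t` times a partial sum of the
series of `e^{-t}`, with `t = α⟨z-a, u-a⟩`. -/
theorem phaseSum_eq (hα : 0 < α) (hg : IntegrableOn g (cube r a) volume) (M : ℕ) (z : Cn n) :
    phaseSum α r a g M z = ((α / Real.pi : ℝ) : ℂ) ^ n • ∫ u in cube r a,
      (Complex.exp (α * herm (z - a) (u - a)) *
        ∑ m ∈ Finset.range M, (-(α * herm (z - a) (u - a))) ^ m / m.factorial) • g u := by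
  have hc : Continuous fun u => herm (z - a) (u - a) := by unfold herm; fun_prop
  have hcm := fun m (φ : Fin m → Fin n) => continuous_monomial φ
  have h1 : ∀ m, ∑ φ : Fin m → Fin n, postFactor α a φ z • fockProj α (testFun α r a g φ) z
      = ((α / Real.pi : ℝ) : ℂ) ^ n • ∫ u in cube r a,
        (Complex.exp (α * herm (z - a) (u - a)) * herm (z - a) (u - a) ^ m) • g u := by
    intro m
    simp only [postFactor_smul_fockProj hα, ← Finset.smul_sum]
    rw [← integral_finsetSum]
    · simp only [← Finset.sum_smul, ← Finset.mul_sum, sum_monomial_mul_conj]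
    · intro φ _
      have := hcm m φ
      exact integrableOn_continuous_smul hg (by fun_prop)
  rw [phaseSum, Finset.sum_congr rfl fun m _ => by rw [h1 m]]
  have h2 : ∀ (c : ℂ) (m : ℕ), c • ((α / Real.pi : ℝ) : ℂ) ^ n • ∫ u in cube r a,
      (Complex.exp (α * herm (z - a) (u - a)) * herm (z - a) (u - a) ^ m) • g u
      = ((α / Real.pi : ℝ) : ℂ) ^ n • ∫ u in cube r a,
        c • (Complex.exp (α * herm (z - a) (u - a)) * herm (z - a) (u - a) ^ m) • g u :=
    fun c m => by rw [smul_comm, integral_smul]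
  simp only [h2]
  rw [← Finset.smul_sum, ← integral_finsetSum]
  · congr 1
    refine integral_congr_ae (Eventually.of_forall fun u => ?_)
    simp only [smul_smul, Finset.mul_sum, Finset.sum_smul]
    refine Finset.sum_congr rfl fun m _ => ?_
    congr 1
    rw [← neg_mul, mul_pow]
    ring
  · intro m _
    exact Integrable.smul ((-α : ℂ) ^ m / m.factorial) (integrableOn_continuous_smul hg
      (f := fun u => Complex.exp (α * herm (z - a) (u - a)) * herm (z - a) (u - a) ^ m)
      (by fun_prop))

/-- The kernels tend to `e^t e^{-t} = 1`, and they are dominated by `e^{2B}`, where `B` bounds `|t|`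
on the cube. -/
theorem tendsto_phaseSum (hα : 0 < α) (hg : IntegrableOn g (cube r a) volume) {z : Cn n}
    (hz : z ∈ cube r a) :
    Tendsto (fun M => phaseSum α r a g M z) atTop
      (𝓝 (((α / Real.pi : ℝ) : ℂ) ^ n • ∫ u in cube r a, g u)) := by
  simp only [phaseSum_eq hα hg]
  have hc : Continuous fun u => herm (z - a) (u - a) := by unfold herm; fun_prop
  set B := α * (n * √(r ^ 2 / 2) ^ 2) with hB
  refine Tendsto.const_smul (tendsto_integral_of_dominated_convergence
    (fun u => Real.exp B * Real.exp B * ‖g u‖) (fun M => ?_) ?_ (fun M => ?_) ?_) _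
  · exact (integrableOn_continuous_smul hg (by fun_prop)).aestronglyMeasurable
  · exact hg.norm.const_mul _
  · filter_upwards [ae_restrict_mem (measurableSet_cube r a)] with u hu
    have ht : ‖(α : ℂ) * herm (z - a) (u - a)‖ ≤ B := by
      rw [norm_mul, Complex.norm_of_nonneg hα.le]
      exact mul_le_mul_of_nonneg_left
        (norm_herm_le (norm_sub_le_of_mem_cube hz) (norm_sub_le_of_mem_cube hu)) hα.le
    rw [norm_smul, norm_mul]
    gcongr
    · rw [Complex.norm_exp]
      exact Real.exp_le_exp.2 ((Complex.re_le_norm _).trans ht)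
    · refine (norm_sum_le _ _).trans ?_
      refine le_trans ?_ ((Real.sum_le_exp_of_nonneg (norm_nonneg _) M).trans
        (Real.exp_le_exp.2 ht))
      refine Finset.sum_le_sum fun m _ => ?_
      rw [norm_div, norm_pow, norm_neg, Complex.norm_natCast]
  · refine Eventually.of_forall fun u => ?_
    have h := (NormedSpace.expSeries_div_hasSum_exp (𝔸 := ℂ)
      (-(α * herm (z - a) (u - a)))).tendsto_sum_nat
    rw [← Complex.exp_eq_exp_ℂ] at h
    have h2 := (h.const_mul (Complex.exp (α * herm (z - a) (u - a)))).smul_const (g u)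
    rwa [← Complex.exp_add, add_neg_cancel, Complex.exp_zero, one_smul] at h2

/-- There are `n^m` words of length `m`, each contributing at most `(r²/2)^m e^{nαr²/2}` times the
bound of `P_α`. With the coefficients `α^m/m!` these sum to at most `e^{nαr²/2} · e^{nαr²/2}`,
uniformly in the number of terms. -/
theorem eLpNorm_phaseSum_le (hW : IsMatrixWeight W) (hα : 0 < α) (hp : 1 ≤ p)
    (hC : FockProjBound α p W C) (hg : AEStronglyMeasurable g volume)
    (hgW : eLpNorm (fun z => mpow (W z) (1 / p) (g z)) (ENNReal.ofReal p)
      (volume.restrict (cube r a)) < ∞) (M : ℕ) :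
    eLpNorm (fun z => mpow (W z) (1 / p) (phaseSum α r a g M z)) (ENNReal.ofReal p)
        (volume.restrict (cube r a)) ≤
      ENNReal.ofReal (Real.exp (n * α * r ^ 2)) * C *
        eLpNorm (fun z => mpow (W z) (1 / p) (g z)) (ENNReal.ofReal p)
          (volume.restrict (cube r a)) := by
  have hp0 : 0 < p := one_pos.trans_le hp
  set G := eLpNorm (fun z => mpow (W z) (1 / p) (g z)) (ENNReal.ofReal p)
    (volume.restrict (cube r a)) with hG
  have hin : ∀ m (φ : Fin m → Fin n), InLpW α p W (testFun α r a g φ) := fun m φ =>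
    ⟨aestronglyMeasurable_testFun hg φ, (normLpW_testFun_le hα hp0 φ).trans_lt
      (ENNReal.mul_lt_top ENNReal.ofReal_lt_top hgW)⟩
  have hP := fun m (φ : Fin m → Fin n) => hC _ (hin m φ)
  set T : (m : ℕ) → (Fin m → Fin n) → Cn n → Cd d := fun m φ z =>
    mpow (W z) (1 / p) (postFactor α a φ z • fockProj α (testFun α r a g φ) z) with hT
  have hTm : ∀ m φ, AEStronglyMeasurable (T m φ) (volume.restrict (cube r a)) := fun m φ =>
    (aestronglyMeasurable_mpow_apply hW _
      ((continuous_postFactor φ).aestronglyMeasurable.smul (hP m φ).2.1)).restrict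
  have hTn : ∀ m φ, eLpNorm (T m φ) (ENNReal.ofReal p) (volume.restrict (cube r a)) ≤
      ENNReal.ofReal ((r ^ 2 / 2) ^ m * Real.exp (n * α * r ^ 2 / 2)) * (C * G) := by
    intro m φ
    refine (eLpNorm_postFactor_smul_le hα hp0 φ _).trans ?_
    refine (mul_le_mul_right ((hP m φ).2.2.trans
      (mul_le_mul_right (normLpW_testFun_le hα hp0 φ) _)) _).trans_eq ?_
    rw [mul_left_comm (C : ℝ≥0∞), ← mul_assoc, ← ENNReal.ofReal_mul (by positivity)]
    congr 2
    rw [mul_mul_mul_comm, ← mul_pow, Real.mul_self_sqrt (by positivity), ← Real.exp_add]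
    congr 2
    ring
  have e : (fun z => mpow (W z) (1 / p) (phaseSum α r a g M z)) =
      ∑ m ∈ Finset.range M, ((-α : ℂ) ^ m / m.factorial) • ∑ φ, T m φ := by
    ext1 z
    simp only [phaseSum, map_sum, map_smul, Finset.sum_apply, Pi.smul_apply, hT]
  have hp' : 1 ≤ ENNReal.ofReal p := by simpa using hp
  rw [e]
  refine (eLpNorm_sum_le (fun m _ => (Finset.aestronglyMeasurable_sum _ fun φ _ =>
    hTm m φ).const_smul _) hp').trans ?_
  have h1 : ∀ m, eLpNorm (((-α : ℂ) ^ m / m.factorial) • ∑ φ, T m φ) (ENNReal.ofReal p)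
      (volume.restrict (cube r a)) ≤ ENNReal.ofReal ((α * (n * (r ^ 2 / 2))) ^ m / m.factorial *
        Real.exp (n * α * r ^ 2 / 2)) * (C * G) := by
    intro m
    rw [eLpNorm_const_smul]
    refine (mul_le_mul_right ((eLpNorm_sum_le (fun φ _ => hTm m φ) hp').trans
      (Finset.sum_le_sum fun φ _ => hTn m φ)) _).trans_eq ?_
    rw [Finset.sum_const, Finset.card_univ, Fintype.card_fun, Fintype.card_fin, Fintype.card_fin,
      nsmul_eq_mul, ← mul_assoc, ← mul_assoc, ← ofReal_norm, ← ENNReal.ofReal_natCast,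
      ← ENNReal.ofReal_mul (by positivity), ← ENNReal.ofReal_mul (by positivity)]
    congr 2
    rw [norm_div, norm_pow, norm_neg, Complex.norm_natCast, Complex.norm_of_nonneg hα.le]
    push_cast
    rw [mul_pow α, mul_pow (n : ℝ)]
    ring
  refine (Finset.sum_le_sum fun m _ => h1 m).trans ?_
  rw [← Finset.sum_mul, mul_assoc _ (C : ℝ≥0∞) G,
    ← ENNReal.ofReal_sum_of_nonneg (fun m _ => by positivity)]
  refine mul_le_mul_left (ENNReal.ofReal_le_ofReal ?_) _
  rw [← Finset.sum_mul]
  refine (mul_le_mul_of_nonneg_right (Real.sum_le_exp_of_nonneg (by positivity) M)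
    (Real.exp_pos _).le).trans_eq ?_
  rw [← Real.exp_add]
  congr 1
  ring

/-- Boundedness of `P_α` makes averaging over cubes bounded. -/
theorem primalAvg_average_le (hW : IsMatrixWeight W) (hα : 0 < α) (hp : 1 ≤ p) (hr : 0 < r)
    (hC : FockProjBound α p W C) (hg : AEStronglyMeasurable g volume)
    (hgW : eLpNorm (fun z => mpow (W z) (1 / p) (g z)) (ENNReal.ofReal p) (avgMeasure r a) < ∞) :
    Integrable g (avgMeasure r a) ∧
      ENNReal.ofReal ((α * r ^ 2 / Real.pi) ^ n) * primalAvg p r W a (∫ u, g u ∂(avgMeasure r a)) ≤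
        ENNReal.ofReal (Real.exp (n * α * r ^ 2)) * C *
          eLpNorm (fun z => mpow (W z) (1 / p) (g z)) (ENNReal.ofReal p) (avgMeasure r a) := by
  have hp0 : 0 < p := one_pos.trans_le hp
  have hv0 : (volume (cube r a))⁻¹ ≠ 0 := ENNReal.inv_ne_zero.2 (volume_cube_ne_top hr a)
  have hscale : ∀ f : Cn n → Cd d, eLpNorm f (ENNReal.ofReal p) (avgMeasure r a)
      = (volume (cube r a))⁻¹ ^ (1 / ENNReal.ofReal p).toReal *
        eLpNorm f (ENNReal.ofReal p) (volume.restrict (cube r a)) := fun f => by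
    rw [avgMeasure, eLpNorm_smul_measure_of_ne_zero hv0, smul_eq_mul]
  have hgW' : eLpNorm (fun z => mpow (W z) (1 / p) (g z)) (ENNReal.ofReal p)
      (volume.restrict (cube r a)) < ∞ := by
    rw [hscale] at hgW
    by_contra h
    rw [not_lt_top_iff.1 h, ENNReal.mul_top] at hgW
    · exact lt_irrefl _ hgW
    · simp [volume_cube_ne_top hr a, volume_cube_ne_zero hr a]
  have hint : IntegrableOn g (cube r a) volume := integrableOn_of_testFun hα
    ((hC _ ⟨aestronglyMeasurable_testFun hg Fin.elim0, (normLpW_testFun_le hα hp0 _).trans_lt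
      (ENNReal.mul_lt_top ENNReal.ofReal_lt_top hgW')⟩).1 a)
  refine ⟨hint.smul_measure (ENNReal.inv_ne_top.2 (volume_cube_ne_zero hr a)), ?_⟩
  -- Passing to the normalized measure multiplies `(α/π)^n` by the volume `r^{2n}`.
  have havg : ((α * r ^ 2 / Real.pi : ℝ) : ℂ) ^ n • (∫ u, g u ∂(avgMeasure r a))
      = ((α / Real.pi : ℝ) : ℂ) ^ n • ∫ u in cube r a, g u := by
    rw [avgMeasure, integral_smul_measure, ENNReal.toReal_inv, volume_cube hr,
      ENNReal.toReal_ofReal (by positivity), ← Complex.coe_smul, smul_smul]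
    congr 1
    rw [← Complex.ofReal_pow, ← Complex.ofReal_pow, ← Complex.ofReal_mul]
    congr 1
    rw [← inv_pow, ← mul_pow]
    congr 1
    field_simp
  -- Fatou's lemma: the uniform bound of the partial sums passes to their pointwise limit, which is
  -- constant on the cube.
  have hlim := Lp.eLpNorm_lim_le_liminf_eLpNorm (μ := volume.restrict (cube r a))
    (p := ENNReal.ofReal p) (f := fun M z => mpow (W z) (1 / p) (phaseSum α r a g M z))
    (fun M => ?_) (fun z => mpow (W z) (1 / p)
      (((α / Real.pi : ℝ) : ℂ) ^ n • ∫ u in cube r a, g u)) ?_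
  · have hle := hlim.trans (liminf_le_of_le (by isBoundedDefault) fun b hb => by
      obtain ⟨M, hM⟩ := hb.exists
      exact hM.trans (eLpNorm_phaseSum_le hW hα hp hC hg hgW' M))
    rw [← havg] at hle
    have h1 : primalAvg p r W a (((α * r ^ 2 / Real.pi : ℝ) : ℂ) ^ n • ∫ u, g u ∂(avgMeasure r a))
        = ENNReal.ofReal ((α * r ^ 2 / Real.pi) ^ n) *
          primalAvg p r W a (∫ u, g u ∂(avgMeasure r a)) := by
      have := Real.pi_pos
      rw [primalAvg_smul, ← Complex.ofReal_pow, ← ofReal_norm,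
        Complex.norm_of_nonneg (by positivity)]
    rw [← h1, primalAvg, hscale, hscale, mul_left_comm _ (_ ^ _)]
    exact mul_le_mul_right hle _
  · refine (aestronglyMeasurable_mpow_apply hW _ ?_).restrict
    refine Finset.aestronglyMeasurable_fun_sum _ fun m _ =>
      AEStronglyMeasurable.fun_const_smul ?_ _
    refine Finset.aestronglyMeasurable_fun_sum _ fun φ _ => ?_
    exact (continuous_postFactor φ).aestronglyMeasurable.smul
      (hC _ ⟨aestronglyMeasurable_testFun hg φ, (normLpW_testFun_le hα hp0 φ).trans_lt
        (ENNReal.mul_lt_top ENNReal.ofReal_lt_top hgW')⟩).2.1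
  · filter_upwards [ae_restrict_mem (measurableSet_cube r a)] with z hz
    exact ((mpow (W z) (1 / p)).continuous.tendsto _).comp (tendsto_phaseSum hα hint hz)

end TestFunctions

/-! ### From boundedness of `P_α` to the `A_{p,r}` condition -/

section LowerBound

open Filter

variable {n d : ℕ} {α p r : ℝ} {W : Cn n → Matrix (Fin d) (Fin d) ℂ} {C : ℝ≥0}

/-- The factor in the lower estimate of `‖P_α‖`. -/
def lowerFactor (n : ℕ) (α r : ℝ) : ℝ :=
  (α * r ^ 2 / Real.pi) ^ n * Real.exp (-(n * α * r ^ 2))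

theorem lowerFactor_pos (hα : 0 < α) (hr : 0 < r) (n : ℕ) : 0 < lowerFactor n α r := by
  have := Real.pi_pos
  unfold lowerFactor; positivity

/-- The left side is the `L^{p'}` norm of `v = W^{-1/p}x`. Each pairing of `|v|` with a scalar `g`
is the pairing of `x` with the average of a vector function of weighted norm at most that of `g`,
and averaging is bounded. -/
theorem dualAvg_le_of_fockProjBound (hW : IsMatrixWeight W) (hα : 0 < α) (hp : 1 ≤ p) (hr : 0 < r)
    (hC : FockProjBound α p W C) (x : Cd d) (a : Cn n) :
    dualAvg p r W a x ≤
      ENNReal.ofReal (lowerFactor n α r)⁻¹ * C * dualNorm (primalAvg p r W a) x := by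
  have hprob := isProbabilityMeasure_avgMeasure hr a
  have hp0 : 0 < p := one_pos.trans_le hp
  set ν := avgMeasure r a with hν
  set v : Cn n → Cd d := fun z => mpow (W z) (-(1 / p)) x with hv
  have hvm : AEStronglyMeasurable v volume :=
    aestronglyMeasurable_mpow_apply hW _ aestronglyMeasurable_const
  have hvν : AEStronglyMeasurable v ν := aestronglyMeasurable_avgMeasure hvm r a
  have e1 : dualAvg p r W a x
      = eLpNorm (fun z => ((‖v z‖₊ : ℝ≥0) : ℝ≥0∞)) (ENNReal.ofReal p).conjExponent ν :=
    (eLpNorm_enorm v).symm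
  rw [e1]
  refine eLpNorm_conjExponent_le hp hvν.nnnorm.aemeasurable fun g hg hgt => ?_
  have hgg' : g =ᵐ[ν] hg.mk g := hg.ae_eq_mk
  have hgm : Measurable (hg.mk g) := hg.measurable_mk
  set g' := hg.mk g with hg'
  have e2 : eLpNorm (fun z => (g z : ℝ≥0∞)) (ENNReal.ofReal p) ν
      = eLpNorm (fun z => (g' z : ℝ≥0∞)) (ENNReal.ofReal p) ν :=
    eLpNorm_congr_ae (by filter_upwards [hgg'] with z hz; rw [hz])
  have e3 : ∫⁻ z, g z * ‖v z‖₊ ∂ν = ∫⁻ z, g' z * ‖v z‖₊ ∂ν :=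
    lintegral_congr_ae (by filter_upwards [hgg'] with z hz; rw [hz])
  rw [e2] at hgt ⊢
  rw [e3]
  -- Chosen so that `⟨x, G⟩ = g|v|` and `|W^{1/p}G| ≤ g`. Where `v = 0` the inverse norm is `0`, and
  -- both relations persist.
  set G : Cn n → Cd d := fun z =>
    ((g' z : ℝ) : ℂ) • mpow (W z) (-(1 / p)) (((‖v z‖⁻¹ : ℝ) : ℂ) • v z) with hG
  have hGm : AEStronglyMeasurable G volume := by
    have h1 : AEStronglyMeasurable (fun z => ((‖v z‖⁻¹ : ℝ) : ℂ)) volume :=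
      (Complex.measurable_ofReal.comp_aemeasurable
        hvm.norm.aemeasurable.inv).aestronglyMeasurable
    have h2 : AEStronglyMeasurable (fun z => ((g' z : ℝ) : ℂ)) volume :=
      (Complex.measurable_ofReal.comp hgm.coe_nnreal_real).aestronglyMeasurable
    exact h2.smul (aestronglyMeasurable_mpow_apply hW _ (h1.smul hvm))
  have hGW : eLpNorm (fun z => mpow (W z) (1 / p) (G z)) (ENNReal.ofReal p) ν
      ≤ eLpNorm (fun z => (g' z : ℝ≥0∞)) (ENNReal.ofReal p) ν := by
    refine eLpNorm_mono_enorm_ae ?_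
    filter_upwards [ae_avgMeasure_of_ae hW.posDef r a] with z hz
    rw [hG, map_smul, mpow_mpow_neg hz, smul_smul, enorm_smul, enorm_mul, enorm_eq_self, mul_assoc]
    have h1 : ‖((‖v z‖⁻¹ : ℝ) : ℂ)‖ₑ * ‖v z‖ₑ ≤ 1 := by
      rw [← ofReal_norm, ← ofReal_norm, ← ENNReal.ofReal_mul (norm_nonneg _),
        Complex.norm_of_nonneg (by positivity)]
      exact ENNReal.ofReal_le_one.2 (inv_mul_le_one)
    have h2 : ‖((g' z : ℝ) : ℂ)‖ₑ = (g' z : ℝ≥0∞) := by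
      rw [← ofReal_norm, Complex.norm_of_nonneg (NNReal.coe_nonneg _), ENNReal.ofReal_coe_nnreal]
    rw [h2]
    exact mul_le_of_le_one_right' h1
  obtain ⟨hint, hle⟩ := primalAvg_average_le hW hα hp hr hC hGm (hGW.trans_lt hgt)
  rw [← hν] at hint hle
  have hinner : ∀ᵐ z ∂ν, inner ℂ x (G z) = ((g' z * ‖v z‖ : ℝ) : ℂ) := by
    filter_upwards [] with z
    rw [hG, inner_smul_right, ← inner_mpow, inner_smul_right]
    change _ * (_ * inner ℂ (v z) (v z)) = _
    rw [inner_self_eq_norm_sq_to_K]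
    by_cases h0 : ‖v z‖ = 0
    · simp [h0]
    · push_cast
      have : ((‖v z‖ : ℝ) : ℂ) ≠ 0 := Complex.ofReal_ne_zero.2 h0
      simp only [Complex.coe_algebraMap]
      field_simp
  have hintr : Integrable (fun z => (g' z * ‖v z‖ : ℝ)) ν := by
    have := (hint.const_inner x).congr hinner
    exact this.re
  have hlint : ∫⁻ z, g' z * ‖v z‖₊ ∂ν = ‖inner ℂ x (∫ z, G z ∂ν)‖ₑ := by
    rw [← integral_inner hint, integral_congr_ae hinner, integral_complex_ofReal, ← ofReal_norm,
      Complex.norm_of_nonneg (integral_nonneg fun z => by positivity),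
      ofReal_integral_eq_lintegral_ofReal hintr (Eventually.of_forall fun z => by
        simp only [Pi.zero_apply]; positivity)]
    refine lintegral_congr fun z => ?_
    rw [ENNReal.ofReal_mul (by positivity), ENNReal.ofReal_coe_nnreal, ofReal_norm]
    rfl
  rw [hlint]
  set A := dualNorm (primalAvg p r W a) x
  set N := primalAvg p r W a (∫ z, G z ∂ν)
  set Gn := eLpNorm (fun z => (g' z : ℝ≥0∞)) (ENNReal.ofReal p) ν
  have hN : N ≤ ENNReal.ofReal (lowerFactor n α r)⁻¹ * C * Gn := by
    have hpi := Real.pi_pos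
    set K := (α * r ^ 2 / Real.pi) ^ n with hK
    have hKp : 0 < K := by positivity
    have h1 : ENNReal.ofReal K⁻¹ * (ENNReal.ofReal K * N) = N := by
      rw [← mul_assoc, ← ENNReal.ofReal_mul (by positivity), inv_mul_cancel₀ hKp.ne',
        ENNReal.ofReal_one, one_mul]
    rw [← h1]
    refine (mul_le_mul_right (hle.trans (mul_le_mul_right hGW _)) _).trans_eq ?_
    rw [← mul_assoc, ← mul_assoc, ← ENNReal.ofReal_mul (by positivity), lowerFactor, mul_inv,
      ← Real.exp_neg, neg_neg]
  calc _ ≤ A * N := enorm_inner_le_dualNorm_primalAvg_mul hW hp hr a x _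
    _ ≤ A * (ENNReal.ofReal (lowerFactor n α r)⁻¹ * C * Gn) := by gcongr
    _ = _ := by ring

theorem aprBound_of_fockProjBound (hW : IsMatrixWeight W) (hα : 0 < α) (hp : 1 ≤ p) (hr : 0 < r)
    (hC : FockProjBound α p W C) :
    AprBound p r (weightMetric p W) ((lowerFactor n α r)⁻¹.toNNReal * C) := by
  rw [aprBound_iff hW]
  intro x u
  rw [ENNReal.coe_mul]
  exact dualAvg_le_of_fockProjBound hW hα hp hr hC x u

theorem isAprWeight_of_fockProjBounded (hW : IsMatrixWeight W) (hd : 0 < d) (hα : 0 < α)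
    (hp : 1 ≤ p) (hr : 0 < r) (h : FockProjBounded α p W) : IsAprWeight p r W := by
  obtain ⟨C, hC⟩ := h
  have hb := aprBound_of_fockProjBound hW hα hp hr hC
  exact ⟨_, one_pos.trans_le (one_le_of_aprBound hW hd hp hr hb), hb⟩

theorem one_le_aprConst (hW : IsMatrixWeight W) (hd : 0 < d) (hp : 1 ≤ p) (hr : 0 < r) :
    1 ≤ aprConst p r W :=
  le_iInf₂ fun _ hC => by exact_mod_cast one_le_of_aprBound hW hd hp hr hC

/-- The argument controls the first power of the constant, which exceeds its square root because it
is at least `1`. -/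
theorem lowerFactor_mul_sqrt_aprConst_le (hW : IsMatrixWeight W) (hd : 0 < d) (hα : 0 < α)
    (hp : 1 ≤ p) (hr : 0 < r) :
    ENNReal.ofReal (lowerFactor n α r) * aprConst p r W ^ (1 / 2 : ℝ) ≤ fockProjNorm α p W := by
  refine le_iInf₂ fun C hC => ?_
  have hL := lowerFactor_pos hα hr n
  have h1 : aprConst p r W ^ (1 / 2 : ℝ) ≤ aprConst p r W :=
    (ENNReal.rpow_le_rpow_of_exponent_le (one_le_aprConst hW hd hp hr) (by norm_num)).trans_eq
      (ENNReal.rpow_one _)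
  have h2 : aprConst p r W ≤ ENNReal.ofReal (lowerFactor n α r)⁻¹ * C :=
    iInf₂_le_of_le _ (aprBound_of_fockProjBound hW hα hp hr hC) (by rw [ENNReal.coe_mul]; rfl)
  refine (mul_le_mul_right (h1.trans h2) _).trans_eq ?_
  rw [← mul_assoc, ← ENNReal.ofReal_mul hL.le, mul_inv_cancel₀ hL.ne', ENNReal.ofReal_one, one_mul]

end LowerBound

/-! ### The maximal projection dominates the projection -/

section Domination

open Filter

variable {n d : ℕ} {α p : ℝ} {W : Cn n → Matrix (Fin d) (Fin d) ℂ} {C : ℝ≥0} {f : Cn n → Cd d}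

theorem lpNorm_mono (hp : 0 ≤ p) {g h : Cn n → ℝ≥0∞} (hgh : ∀ᵐ z, g z ≤ h z) :
    lpNorm α p g ≤ lpNorm α p h := by
  unfold lpNorm
  refine ENNReal.rpow_le_rpow (lintegral_mono_ae ?_) (by positivity)
  filter_upwards [hgh] with z hz
  gcongr

theorem ae_lt_top_of_lpNorm_lt_top (hp : 0 < p) {g : Cn n → ℝ≥0∞} (hg : AEMeasurable g volume)
    (h : lpNorm α p g < ∞) : ∀ᵐ z, g z < ∞ := by
  unfold lpNorm at h
  have h1 := (ENNReal.rpow_lt_top_iff_of_pos (one_div_pos.2 hp)).1 h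
  have hm : AEMeasurable (fun z => g z ^ p *
      ENNReal.ofReal (Real.exp (-(p * α / 2) * sqNorm z))) volume := by
    have := continuous_sqNorm (n := n)
    exact (hg.pow_const p).mul (by fun_prop : Continuous fun z : Cn n =>
      Real.exp (-(p * α / 2) * sqNorm z)).measurable.ennreal_ofReal.aemeasurable
  filter_upwards [ae_lt_top' hm h1.ne] with z hz
  by_contra hc
  rw [not_lt_top_iff] at hc
  rw [hc, ENNReal.top_rpow_of_pos hp, ENNReal.top_mul
    (by simp [Real.exp_pos])] at hz
  exact lt_irrefl _ hz

instance instSFiniteGaussian : SFinite (gaussian n α) := by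
  unfold gaussian; infer_instance

theorem herm_add_left (u v z : Cn n) : herm (u + v) z = herm u z + herm v z := by
  simp [herm, add_mul, Finset.sum_add_distrib]

/-- One of `e^{x+y}` and `e^{x-y}` is at least `e^x`. -/
theorem enorm_kernel_le (α : ℝ) (z h u : Cn n) :
    ‖kernel α z u‖ₑ ≤ ‖kernel α (z + h) u‖ₑ + ‖kernel α (z - h) u‖ₑ := by
  rw [← ofReal_norm, ← ofReal_norm, ← ofReal_norm, ← ENNReal.ofReal_add (norm_nonneg _)
    (norm_nonneg _)]
  refine ENNReal.ofReal_le_ofReal ?_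
  simp only [norm_kernel, herm_add_left, herm_sub_left, Complex.add_re, Complex.sub_re, mul_add,
    mul_sub]
  set x := α * (herm z u).re
  set y := α * (herm h u).re
  rcases le_total 0 y with hy | hy
  · have h1 : Real.exp x ≤ Real.exp (x + y) := Real.exp_le_exp.2 (by linarith)
    linarith [Real.exp_pos (x - y)]
  · have h1 : Real.exp x ≤ Real.exp (x - y) := Real.exp_le_exp.2 (by linarith)
    linarith [Real.exp_pos (x + y)]

/-- Since `z ↦ |K_z|` is convex along lines, absolute convergence at almost every point is
absolute convergence at every point. -/
theorem lintegral_kernel_lt_top_of_ae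
    (hf : AEStronglyMeasurable f volume)
    (h : ∀ᵐ z, ∫⁻ u, ‖f u‖ₑ * ‖kernel α z u‖ₑ ∂(gaussian n α) < ∞) (z : Cn n) :
    ∫⁻ u, ‖f u‖ₑ * ‖kernel α z u‖ₑ ∂(gaussian n α) < ∞ := by
  -- For almost every `w` both `z + w` and `z - w` are good points, so some such pair surrounds any
  -- given `z`.
  have h1 : ∀ᵐ w, ∫⁻ u, ‖f u‖ₑ * ‖kernel α (z + w) u‖ₑ ∂(gaussian n α) < ∞ :=
    (measurePreserving_add_left volume z).quasiMeasurePreserving.ae h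
  have h2 : ∀ᵐ w, ∫⁻ u, ‖f u‖ₑ * ‖kernel α (z - w) u‖ₑ ∂(gaussian n α) < ∞ :=
    (Measure.measurePreserving_sub_left volume z).quasiMeasurePreserving.ae h
  obtain ⟨w, hw1, hw2⟩ := (h1.and h2).exists
  have hm : AEMeasurable (fun u => ‖f u‖ₑ * ‖kernel α (z + w) u‖ₑ) (gaussian n α) :=
    (hf.mono_ac gaussian_absolutelyContinuous).enorm.mul
      (continuous_kernel.comp (by fun_prop :
        Continuous fun u : Cn n => (z + w, u))).measurable.enorm.aemeasurable
  calc _ ≤ ∫⁻ u, ‖f u‖ₑ * ‖kernel α (z + w) u‖ₑ + ‖f u‖ₑ * ‖kernel α (z - w) u‖ₑ ∂(gaussian n α) :=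
        lintegral_mono fun u => by
          rw [← mul_add]; exact mul_le_mul_right (enorm_kernel_le α z w u) _
    _ = _ := lintegral_add_left' hm _
    _ < ∞ := ENNReal.add_lt_top.2 ⟨hw1, hw2⟩

theorem aestronglyMeasurable_fockProj (hf : AEStronglyMeasurable f volume) :
    AEStronglyMeasurable (fockProj α f) volume := by
  have hsm : StronglyMeasurable fun z => ∫ u, conj (kernel α z u) • hf.mk f u ∂(gaussian n α) := by
    refine StronglyMeasurable.integral_prod_right
      (f := fun z u => conj (kernel α z u) • hf.mk f u) ?_
    exact (Complex.continuous_conj.comp continuous_kernel).stronglyMeasurable.smul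
      (hf.stronglyMeasurable_mk.comp_measurable measurable_snd)
  refine hsm.aestronglyMeasurable.congr (Eventually.of_forall fun z => ?_)
  refine integral_congr_ae ?_
  filter_upwards [gaussian_absolutelyContinuous.ae_le hf.ae_eq_mk] with u hu
  rw [hu]

theorem maxFockProj_mpow (hW : IsMatrixWeight W) (f : Cn n → Cd d) (z : Cn n) :
    maxFockProj α p W (fun u => mpow (W u) (1 / p) (f u)) z =
      ∫⁻ u, ‖mpow (W z) (1 / p) (f u)‖ₑ * ‖kernel α z u‖ₑ ∂(gaussian n α) := by
  refine lintegral_congr_ae ?_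
  filter_upwards [gaussian_absolutelyContinuous.ae_le hW.posDef] with u hu
  rw [mpow_neg_mpow hu]

/-- The maximal Fock projection dominates the Fock projection. -/
theorem fockProjBound_of_maxFockProjBound (hW : IsMatrixWeight W) (hp : 1 ≤ p)
    (hC : MaxFockProjBound α p W C) : FockProjBound α p W C := by
  intro f hf
  have hp0 : 0 < p := one_pos.trans_le hp
  obtain ⟨hm, hle⟩ := hC (fun u => mpow (W u) (1 / p) (f u))
    ⟨aestronglyMeasurable_mpow_apply hW _ hf.1, hf.2⟩
  have hfin : lpNorm α p (maxFockProj α p W fun u => mpow (W u) (1 / p) (f u)) < ∞ :=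
    hle.trans_lt (ENNReal.mul_lt_top ENNReal.coe_lt_top hf.2)
  -- For fixed `z` the invertible matrix `W^{1/p}(z)` can be removed at the cost of the finite norm
  -- of its inverse.
  have hae : ∀ᵐ z, ∫⁻ u, ‖f u‖ₑ * ‖kernel α z u‖ₑ ∂(gaussian n α) < ∞ := by
    filter_upwards [hW.posDef, ae_lt_top_of_lpNorm_lt_top hp0 hm hfin] with z hz hzt
    rw [maxFockProj_mpow hW] at hzt
    refine lt_of_le_of_lt (b := ‖mpow (W z) (-(1 / p))‖ₑ *
      ∫⁻ u, ‖mpow (W z) (1 / p) (f u)‖ₑ * ‖kernel α z u‖ₑ ∂(gaussian n α)) ?_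
      (ENNReal.mul_lt_top (by simp) hzt)
    rw [← lintegral_const_mul' _ _ (by simp)]
    refine lintegral_mono fun u => ?_
    rw [← mul_assoc]
    refine mul_le_mul_left ?_ _
    conv_lhs => rw [← mpow_neg_mpow hz (1 / p) (f u)]
    exact (mpow (W z) (-(1 / p))).le_opENorm _
  have hint : ∀ z, Integrable (fun u => conj (kernel α z u) • f u) (gaussian n α) := by
    intro z
    refine ⟨?_, ?_⟩
    · exact (Complex.continuous_conj.comp (continuous_kernel.comp
        (by fun_prop : Continuous fun u : Cn n => (z, u)))).aestronglyMeasurable.smul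
        (hf.1.mono_ac gaussian_absolutelyContinuous)
    · refine lt_of_le_of_lt (lintegral_mono fun u => ?_) (lintegral_kernel_lt_top_of_ae hf.1 hae z)
      rw [enorm_smul, mul_comm, RCLike.enorm_conj]
  refine ⟨hint, aestronglyMeasurable_fockProj hf.1, ?_⟩
  refine (lpNorm_mono hp0.le (Eventually.of_forall fun z => ?_)).trans hle
  rw [maxFockProj_mpow hW, fockProj, ← ContinuousLinearMap.integral_comp_comm _ (hint z)]
  refine (enorm_integral_le_lintegral_enorm _).trans (lintegral_mono fun u => ?_)
  rw [map_smul, enorm_smul, mul_comm, RCLike.enorm_conj]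

theorem fockProjNorm_le_maxFockProjNorm (hW : IsMatrixWeight W) (hp : 1 ≤ p) :
    fockProjNorm α p W ≤ maxFockProjNorm α p W :=
  le_iInf₂ fun _ hC => iInf₂_le _ (fockProjBound_of_maxFockProjBound hW hp hC)

end Domination

/-! ### Nearly Auerbach bases -/

section NearAuerbach

variable {d : ℕ}

/-- A weak form of Auerbach's lemma: every norm on `ℂᵈ` has a basis of vectors of norm at most `1`
whose dual basis consists of functionals of norm at most `2`. -/
theorem exists_near_auerbach_basis {N : Cd d → ℝ≥0∞} {c : ℝ≥0∞} (hc : c ≠ 0)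
    (hcN : ∀ y, c * ‖y‖ₑ ≤ N y) (hfin : ∀ y, N y < ∞)
    (hsmul : ∀ (t : ℂ) (y : Cd d), N (t • y) = ‖t‖ₑ * N y) :
    ∃ b b' : Fin d → Cd d, (∀ k, N (b k) ≤ 1) ∧ (∀ k, dualNorm N (b' k) ≤ 2) ∧
      ∀ y, y = ∑ k, inner ℂ (b' k) y • b k := by
  let mat : (Fin d → Cd d) → Matrix (Fin d) (Fin d) ℂ := fun b => Matrix.of fun i k => b k i
  have hpos : ∀ y : Cd d, y ≠ 0 → N y ≠ 0 := fun y hy h0 => by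
    have := hcN y
    rw [h0, nonpos_iff_eq_zero, mul_eq_zero] at this
    exact hy (by simpa using this.resolve_left hc)
  have hnormalize : ∀ y : Cd d, y ≠ 0 → N ((((N y).toReal⁻¹ : ℝ) : ℂ) • y) ≤ 1 := fun y hy => by
    rw [hsmul, ← ofReal_norm, Complex.norm_of_nonneg (by positivity),
      ENNReal.ofReal_inv_of_pos (ENNReal.toReal_pos (hpos y hy) (hfin y).ne),
      ENNReal.ofReal_toReal (hfin y).ne, ENNReal.inv_mul_cancel (hpos y hy) (hfin y).ne]
  -- The absolute determinants of `d`-tuples from the unit ball. A maximizer would give constant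
  -- `1`; a tuple above half the supremum gives `2` and needs no compactness.
  let S : Set ℝ := {t | ∃ b : Fin d → Cd d, (∀ k, N (b k) ≤ 1) ∧ ‖(mat b).det‖ = t}
  have hbdd : BddAbove S := by
    refine ⟨(Fintype.card (Fin d)).factorial • (c⁻¹).toReal ^ Fintype.card (Fin d), ?_⟩
    rintro t ⟨b, hb, rfl⟩
    refine Matrix.det_le (abv := NormedField.toAbsoluteValue ℂ) (x := (c⁻¹).toReal) fun i k => ?_
    refine (PiLp.norm_apply_le (b k) i).trans ?_
    have h1 : ‖b k‖ₑ ≤ c⁻¹ := by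
      rw [← one_div, ENNReal.le_div_iff_mul_le (Or.inl hc) (Or.inr ENNReal.one_ne_top), mul_comm]
      exact (hcN _).trans (hb k)
    have := ENNReal.toReal_mono (ENNReal.inv_ne_top.2 hc) h1
    rwa [toReal_enorm] at this
  have hspos : ∃ t ∈ S, 0 < t := by
    let e : Fin d → Cd d := fun k => EuclideanSpace.single k 1
    have he : ∀ k, e k ≠ 0 := fun k => by simp [e]
    refine ⟨_, ⟨fun k => (((N (e k)).toReal⁻¹ : ℝ) : ℂ) • e k, fun k => hnormalize _ (he k), rfl⟩, ?_⟩
    have hm : mat (fun k => (((N (e k)).toReal⁻¹ : ℝ) : ℂ) • e k)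
        = Matrix.diagonal fun k => (((N (e k)).toReal⁻¹ : ℝ) : ℂ) := by
      ext i k
      by_cases hik : i = k
      · subst hik; simp [mat, e]
      · simp [mat, e, hik]
    rw [hm, Matrix.det_diagonal, norm_pos_iff]
    refine Finset.prod_ne_zero_iff.2 fun k _ => ?_
    rw [Complex.ofReal_ne_zero]
    exact inv_ne_zero (ENNReal.toReal_pos (hpos _ (he k)) (hfin _).ne).ne'
  obtain ⟨t₀, ht₀, ht₀pos⟩ := hspos
  have hs : 0 < sSup S := ht₀pos.trans_le (le_csSup hbdd ht₀)
  obtain ⟨_, ⟨b, hb, rfl⟩, hbs⟩ := exists_lt_of_lt_csSup ⟨t₀, ht₀⟩ (half_lt_self hs)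
  have hdet : (mat b).det ≠ 0 := fun h => by
    rw [h, norm_zero] at hbs; linarith
  let l : Fin d → (Cd d →ₗ[ℂ] ℂ) := fun k => ((mat b).det)⁻¹ •
    (LinearMap.proj k ∘ₗ (mat b).cramer ∘ₗ (WithLp.linearEquiv 2 ℂ (Fin d → ℂ)).toLinearMap)
  have hl : ∀ k y, l k y = ((mat b).det)⁻¹ * (mat b).cramer (y : Fin d → ℂ) k := fun k y => rfl
  let b' : Fin d → Cd d := fun k =>
    (InnerProductSpace.toDual ℂ (Cd d)).symm (LinearMap.toContinuousLinearMap (l k))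
  have hb' : ∀ k y, inner ℂ (b' k) y = l k y := fun k y => by
    simp only [b', InnerProductSpace.toDual_symm_apply]; rfl
  refine ⟨b, b', hb, fun k => iSup₂_le fun y hy => ?_, fun y => ?_⟩
  · refine ENNReal.div_le_of_le_mul ?_
    -- By Cramer's rule the coordinate is a quotient of determinants. Its numerator, with the `k`-th
    -- vector replaced by `y`, is at most `sup S`, and its denominator exceeds half of that.
    have hle : ∀ y, N y ≤ 1 → ‖l k y‖ ≤ 2 := by
      intro y hy
      have hmem : ‖(mat (Function.update b k y)).det‖ ∈ S := by
        refine ⟨_, fun j => ?_, rfl⟩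
        by_cases hj : j = k
        · subst hj; simpa using hy
        · simpa [hj] using hb j
      have hup : (mat b).updateCol k (y : Fin d → ℂ) = mat (Function.update b k y) := by
        ext i j
        by_cases hj : j = k
        · subst hj; simp [mat]
        · simp [mat, hj]
      rw [hl, Matrix.cramer_apply, hup, norm_mul, norm_inv, inv_mul_le_iff₀ (norm_pos_iff.2 hdet)]
      have := le_csSup hbdd hmem
      linarith
    have h1 := hle _ (hnormalize y hy)
    have htp := ENNReal.toReal_pos (hpos y hy) (hfin y).ne
    rw [map_smul, norm_smul, Complex.norm_of_nonneg (by positivity), inv_mul_le_iff₀ htp] at h1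
    rw [hb', ← ofReal_norm, ← ENNReal.ofReal_toReal (hfin y).ne]
    calc _ ≤ ENNReal.ofReal ((N y).toReal * 2) := ENNReal.ofReal_le_ofReal h1
      _ = _ := by
        rw [mul_comm, ENNReal.ofReal_mul (by norm_num), ENNReal.ofReal_ofNat]
  · have h := Matrix.mulVec_cramer (mat b) (y : Fin d → ℂ)
    ext i
    have hi := congrFun h i
    simp only [Matrix.mulVec, dotProduct, Pi.smul_apply, smul_eq_mul] at hi
    simp only [hb', hl, WithLp.ofLp_sum, WithLp.ofLp_smul, Finset.sum_apply, Pi.smul_apply,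
      smul_eq_mul]
    have h2 : y i = (mat b).det⁻¹ * ((mat b).det * y i) := (inv_mul_cancel_left₀ hdet _).symm
    rw [h2, ← hi, Finset.mul_sum]
    refine Finset.sum_congr rfl fun k _ => ?_
    simp only [mat, Matrix.of_apply]
    ring

end NearAuerbach

/-! ### Comparison along chains of cubes -/

section Chain

variable {n d : ℕ} {p r : ℝ} {W : Cn n → Matrix (Fin d) (Fin d) ℂ}

/-- Consecutive centres differ by at most half a side in each real coordinate, so each step costs
one factor of the comparison of near cubes. -/
theorem dualNorm_primalAvg_chain (hW : IsMatrixWeight W) (hp : 1 ≤ p) (hr : 0 < r) {C : ℝ≥0}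
    (hC : AprBound p r (weightMetric p W) C) {h : Cn n}
    (hh : ∀ j, |(h j).re| ≤ r / 2 ∧ |(h j).im| ≤ r / 2) (x : Cd d) (u : Cn n) (k : ℕ) :
    dualNorm (primalAvg p r W (u + (k : ℂ) • h)) x ≤
      (16 ^ n * C) ^ k * dualNorm (primalAvg p r W u) x := by
  induction k with
  | zero => simp
  | succ k ih =>
    refine (dualNorm_primalAvg_le_of_near hW hp hr hC (u := u + (k : ℂ) • h) (fun j => ?_) x).trans
      ((mul_le_mul_right ih _).trans_eq (by rw [pow_succ]; ring))
    have e : (u + (k : ℂ) • h) j - (u + ((k + 1 : ℕ) : ℂ) • h) j = -h j := by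
      simp only [Pi.add_apply, Pi.smul_apply, smul_eq_mul]; push_cast; ring
    rw [e, Complex.neg_re, Complex.neg_im, abs_neg, abs_neg]
    exact hh j

end Chain

/-! ### The grid of cells, Gaussian sums and the cost of chains -/

section Cells

variable {n : ℕ} {r : ℝ}

/-- The index of the cell of side length `r` which contains `z`. -/
def cellIndex (r : ℝ) (z : Cn n) : Fin n → ℤ × ℤ := fun j => (⌊(z j).re / r⌋, ⌊(z j).im / r⌋)

/-- The centre of a cell. -/
def cellCenter (r : ℝ) (m : Fin n → ℤ × ℤ) : Cn n :=
  fun j => ⟨r * ((m j).1 + 1 / 2), r * ((m j).2 + 1 / 2)⟩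

/-- The half-open cell of side length `r` with the given index. -/
def cell (r : ℝ) (m : Fin n → ℤ × ℤ) : Set (Cn n) := cellIndex r ⁻¹' {m}

/-- The squared length of an index. -/
def indexSq (m : Fin n → ℤ × ℤ) : ℝ := ∑ j, (((m j).1 : ℝ) ^ 2 + ((m j).2 : ℝ) ^ 2)

/-- The number of half-side steps which join cubes whose indices differ by `m`. -/
def indexSteps (m : Fin n → ℤ × ℤ) : ℕ := ∑ j, 2 * ((m j).1.natAbs + (m j).2.natAbs)

theorem measurable_cellIndex : Measurable (cellIndex (n := n) r) := by
  refine measurable_pi_lambda _ fun j => Measurable.prodMk ?_ ?_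
  · exact Int.measurable_floor.comp
      ((Complex.measurable_re.comp (measurable_pi_apply j)).div_const r)
  · exact Int.measurable_floor.comp
      ((Complex.measurable_im.comp (measurable_pi_apply j)).div_const r)

theorem measurableSet_cell (m : Fin n → ℤ × ℤ) : MeasurableSet (cell r m) :=
  measurable_cellIndex (measurableSet_singleton m)

theorem lintegral_eq_tsum_cell (r : ℝ) (f : Cn n → ℝ≥0∞) :
    ∫⁻ z, f z = ∑' m, ∫⁻ z in cell r m, f z := by
  rw [← lintegral_iUnion measurableSet_cell]
  · rw [show (⋃ m, cell (n := n) r m) = Set.univ by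
      ext z; simp [cell], setLIntegral_univ]
  · intro m m' hmm'
    exact Set.disjoint_left.2 fun z hz hz' => hmm' (hz.symm.trans hz')

theorem cell_coord (hr : 0 < r) {x : ℝ} {k : ℤ} (h : ⌊x / r⌋ = k) : r * k ≤ x ∧ x < r * (k + 1) := by
  rw [Int.floor_eq_iff, le_div_iff₀ hr, div_lt_iff₀ hr] at h
  constructor <;> linarith

theorem cell_subset_cube (hr : 0 < r) (m : Fin n → ℤ × ℤ) :
    cell r m ⊆ cube r (cellCenter r m) := by
  intro z hz j
  have hz : cellIndex r z = m := hz
  obtain ⟨h1, h2⟩ := cell_coord hr (congrArg Prod.fst (congrFun hz j))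
  obtain ⟨h3, h4⟩ := cell_coord hr (congrArg Prod.snd (congrFun hz j))
  simp only [cellCenter, Complex.sub_re, Complex.sub_im, abs_le]
  refine ⟨⟨?_, ?_⟩, ?_, ?_⟩ <;> nlinarith

/-- In units of `r`, the difference of two points is within `1` of the difference of their cell
indices; then `(a + b)² ≤ 2a² + 2b²`. -/
theorem cell_coord_sub (hr : 0 < r) {x y : ℝ} {k l : ℤ} (hx : ⌊x / r⌋ = k) (hy : ⌊y / r⌋ = l) :
    r ^ 2 * (((k - l : ℤ) : ℝ) ^ 2 / 2 - 1) ≤ (x - y) ^ 2 := by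
  obtain ⟨h1, h2⟩ := cell_coord hr hx
  obtain ⟨h3, h4⟩ := cell_coord hr hy
  push_cast
  obtain ⟨s, rfl⟩ : ∃ s, x = r * s := ⟨x / r, by field_simp⟩
  obtain ⟨t, rfl⟩ : ∃ t, y = r * t := ⟨y / r, by field_simp⟩
  have h1 := le_of_mul_le_mul_left h1 hr
  have h2 := lt_of_mul_lt_mul_left h2 hr.le
  have h3 := le_of_mul_le_mul_left h3 hr
  have h4 := lt_of_mul_lt_mul_left h4 hr.le
  rw [← mul_sub, mul_pow]
  refine mul_le_mul_of_nonneg_left ?_ (by positivity)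
  have hδ : ((s - t) - (k - l)) ^ 2 ≤ 1 := by
    rw [sq_le_one_iff_abs_le_one, abs_le]; constructor <;> linarith
  nlinarith [sq_nonneg (2 * (s - t) - ((k : ℝ) - l))]

theorem le_sqNorm_sub_of_mem_cell (hr : 0 < r) {i j : Fin n → ℤ × ℤ} {z u : Cn n}
    (hz : z ∈ cell r i) (hu : u ∈ cell r j) :
    r ^ 2 * (indexSq (i - j) / 2 - 2 * n) ≤ sqNorm (z - u) := by
  have hz : cellIndex r z = i := hz
  have hu : cellIndex r u = j := hu
  calc r ^ 2 * (indexSq (i - j) / 2 - 2 * n)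
      = ∑ l : Fin n, r ^ 2 * (((((i - j) l).1 : ℝ) ^ 2 + (((i - j) l).2 : ℝ) ^ 2) / 2 - 2) := by
        rw [← Finset.mul_sum, Finset.sum_sub_distrib, indexSq, Finset.sum_div]
        simp [mul_comm]
    _ ≤ sqNorm (z - u) := by
        refine Finset.sum_le_sum fun l _ => ?_
        rw [← Complex.normSq_eq_norm_sq, Complex.normSq_apply]
        have h1 := cell_coord_sub hr (congrArg Prod.fst (congrFun hz l))
          (congrArg Prod.fst (congrFun hu l))
        have h2 := cell_coord_sub hr (congrArg Prod.snd (congrFun hz l))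
          (congrArg Prod.snd (congrFun hu l))
        simp only [Pi.sub_apply, Prod.fst_sub, Prod.snd_sub, Complex.sub_re, Complex.sub_im]
        linarith

/-- The straight segment between the centres is divided into `N` equal steps. Since `N` is at least
twice every index difference, a step moves each coordinate by at most `r/2`. If `N = 0` the indices
agree and division by zero yields the zero step. -/
theorem exists_step (hr : 0 < r) (i j : Fin n → ℤ × ℤ) : ∃ h : Cn n,
    (∀ l, |(h l).re| ≤ r / 2 ∧ |(h l).im| ≤ r / 2) ∧
      cellCenter r j = cellCenter r i + (indexSteps (i - j) : ℂ) • h := by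
  set N := indexSteps (i - j) with hN
  have hle : ∀ l, 2 * (((i - j) l).1.natAbs + ((i - j) l).2.natAbs) ≤ N := fun l =>
    Finset.single_le_sum (f := fun l => 2 * (((i - j) l).1.natAbs + ((i - j) l).2.natAbs))
      (fun _ _ => Nat.zero_le _) (Finset.mem_univ l)
  have habs : ∀ l, 2 * |((i l).1 : ℝ) - (j l).1| ≤ N ∧ 2 * |((i l).2 : ℝ) - (j l).2| ≤ N := by
    intro l
    have h1 : ∀ a b : ℤ, |(a : ℝ) - b| = ((a - b).natAbs : ℝ) := fun a b => by
      rw [Nat.cast_natAbs, Int.cast_abs, Int.cast_sub]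
    have h2 := hle l
    simp only [Pi.sub_apply, Prod.fst_sub, Prod.snd_sub] at h2
    rw [h1, h1]
    constructor <;> · norm_cast; omega
  refine ⟨fun l => ⟨r * (((j l).1 : ℝ) - (i l).1) / N, r * (((j l).2 : ℝ) - (i l).2) / N⟩,
    fun l => ?_, ?_⟩
  · simp only [abs_div, abs_mul, abs_of_pos hr, Nat.abs_cast]
    rw [abs_sub_comm ((j l).1 : ℝ), abs_sub_comm ((j l).2 : ℝ)]
    obtain ⟨h1, h2⟩ := habs l
    rcases Nat.eq_zero_or_pos N with h0 | h0
    · simp only [h0, Nat.cast_zero, div_zero]; constructor <;> positivity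
    · have : (0 : ℝ) < N := by exact_mod_cast h0
      rw [div_le_iff₀ this, div_le_iff₀ this]
      constructor <;> nlinarith
  · ext l
    obtain ⟨h1, h2⟩ := habs l
    rcases Nat.eq_zero_or_pos N with h0 | h0
    · rw [h0] at h1 h2
      have h1 : ((i l).1 : ℝ) - (j l).1 = 0 := abs_nonpos_iff.1 (by
        rw [Nat.cast_zero] at h1; linarith)
      have h2 : ((i l).2 : ℝ) - (j l).2 = 0 := abs_nonpos_iff.1 (by
        rw [Nat.cast_zero] at h2; linarith)
      simp only [h0, Nat.cast_zero, zero_smul, add_zero, cellCenter, sub_eq_zero.1 h1,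
        sub_eq_zero.1 h2]
    · have hne : (N : ℝ) ≠ 0 := by positivity
      have e : ((N : ℂ) • (fun l => (⟨r * (((j l).1 : ℝ) - (i l).1) / N,
          r * (((j l).2 : ℝ) - (i l).2) / N⟩ : ℂ))) l
          = ⟨r * (((j l).1 : ℝ) - (i l).1), r * (((j l).2 : ℝ) - (i l).2)⟩ := by
        rw [Pi.smul_apply, smul_eq_mul, ← Complex.ofReal_natCast]
        apply Complex.ext
        · rw [Complex.re_ofReal_mul]; field_simp
        · rw [Complex.im_ofReal_mul]; field_simp
      rw [Pi.add_apply, e]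
      apply Complex.ext
      · simp only [cellCenter, Complex.add_re]; ring
      · simp only [cellCenter, Complex.add_im]; ring

theorem tsum_prod_pi {ι : Type*} (f : ι → ℝ≥0∞) (n : ℕ) :
    ∑' m : Fin n → ι, ∏ j, f (m j) = (∑' i, f i) ^ n := by
  induction n with
  | zero => simp
  | succ n ih =>
    rw [← (Fin.consEquiv fun _ : Fin (n + 1) => ι).tsum_eq]
    have h : ∀ q : ι × (Fin n → ι), ∏ j, f ((Fin.consEquiv fun _ : Fin (n + 1) => ι) q j)
        = f q.1 * ∏ j, f (q.2 j) := fun q => by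
      simp [Fin.consEquiv_apply, Fin.prod_univ_succ]
    simp only [h]
    rw [ENNReal.tsum_prod (f := fun a (b : Fin n → ι) => f a * ∏ j, f (b j))]
    simp only [ENNReal.tsum_mul_left, ih, ENNReal.tsum_mul_right]
    rw [pow_succ, mul_comm]

theorem tsum_int_exp_lt_top {δ : ℝ} (hδ : 0 < δ) :
    ∑' k : ℤ, ENNReal.ofReal (Real.exp (-δ * (k : ℝ) ^ 2)) < ∞ := by
  have hs : Summable fun k : ℤ => Real.exp (-δ * (k : ℝ) ^ 2) := by
    have h : Summable fun k : ℕ => Real.exp (-δ * (k : ℝ) ^ 2) := by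
      refine Summable.of_nonneg_of_le (fun _ => (Real.exp_pos _).le) (fun k => ?_)
        (Real.summable_exp_nat_mul_iff.2 (neg_lt_zero.2 hδ))
      rw [Real.exp_le_exp]
      have : (k : ℝ) ≤ (k : ℝ) ^ 2 := by exact_mod_cast Nat.le_self_pow two_ne_zero k
      nlinarith
    refine Summable.of_nat_of_neg (by simpa using h) (by simpa using h)
  rw [← ENNReal.ofReal_tsum_of_nonneg (fun _ => (Real.exp_pos _).le) hs]
  exact ENNReal.ofReal_lt_top

/-- The Gaussian sum over all indices. -/
def indexSum (n : ℕ) (δ : ℝ) : ℝ≥0∞ :=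
  ∑' m : Fin n → ℤ × ℤ, ENNReal.ofReal (Real.exp (-δ * indexSq m))

/-- The sum factors into `2n` one-dimensional Gaussian sums over `ℤ`. -/
theorem indexSum_lt_top {δ : ℝ} (hδ : 0 < δ) : indexSum n δ < ∞ := by
  have h1 : ∀ m : Fin n → ℤ × ℤ, ENNReal.ofReal (Real.exp (-δ * indexSq m)) =
      ∏ j, (ENNReal.ofReal (Real.exp (-δ * ((m j).1 : ℝ) ^ 2)) *
        ENNReal.ofReal (Real.exp (-δ * ((m j).2 : ℝ) ^ 2))) := fun m => by
    simp only [indexSq, Finset.mul_sum, Real.exp_sum]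
    rw [ENNReal.ofReal_prod_of_nonneg fun _ _ => (Real.exp_pos _).le]
    refine Finset.prod_congr rfl fun j _ => ?_
    rw [← ENNReal.ofReal_mul (Real.exp_pos _).le, ← Real.exp_add, mul_add]
  simp only [indexSum, h1]
  rw [tsum_prod_pi fun q : ℤ × ℤ => ENNReal.ofReal (Real.exp (-δ * (q.1 : ℝ) ^ 2)) *
        ENNReal.ofReal (Real.exp (-δ * (q.2 : ℝ) ^ 2)),
    ENNReal.tsum_prod (f := fun a b : ℤ => ENNReal.ofReal (Real.exp (-δ * (a : ℝ) ^ 2)) *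
        ENNReal.ofReal (Real.exp (-δ * (b : ℝ) ^ 2)))]
  simp only [ENNReal.tsum_mul_left, ENNReal.tsum_mul_right]
  exact ENNReal.pow_lt_top (ENNReal.mul_lt_top (tsum_int_exp_lt_top hδ) (tsum_int_exp_lt_top hδ))

/-- The inequality `2Lt ≤ (γ/2)t² + 2L²/γ` in each of the `2n` coordinates. It lets quadratic decay
absorb a linear number of steps, leaving a term quadratic in `L`. -/
theorem mul_indexSteps_le {L γ : ℝ} (hγ : 0 < γ) (m : Fin n → ℤ × ℤ) :
    L * indexSteps m ≤ γ / 2 * indexSq m + 4 * n * L ^ 2 / γ := by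
  have h1 : ∀ k : ℤ, L * (2 * (k.natAbs : ℝ)) ≤ γ / 2 * (k : ℝ) ^ 2 + 2 * L ^ 2 / γ := by
    intro k
    rw [Nat.cast_natAbs, Int.cast_abs, ← sq_abs (k : ℝ)]
    set t := |(k : ℝ)|
    have h := sq_nonneg (γ * t - 2 * L)
    have h2 : γ / 2 * t ^ 2 + 2 * L ^ 2 / γ - L * (2 * t) = (γ * t - 2 * L) ^ 2 / (2 * γ) := by
      field_simp; ring
    have : 0 ≤ (γ * t - 2 * L) ^ 2 / (2 * γ) := by positivity
    linarith
  calc L * indexSteps m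
      = ∑ j, (L * (2 * ((m j).1.natAbs : ℝ)) + L * (2 * ((m j).2.natAbs : ℝ))) := by
        rw [indexSteps]; push_cast; rw [Finset.mul_sum]
        refine Finset.sum_congr rfl fun j _ => by ring
    _ ≤ ∑ j : Fin n, ((γ / 2 * ((m j).1 : ℝ) ^ 2 + 2 * L ^ 2 / γ) +
          (γ / 2 * ((m j).2 : ℝ) ^ 2 + 2 * L ^ 2 / γ)) :=
        Finset.sum_le_sum fun j _ => add_le_add (h1 _) (h1 _)
    _ = _ := by
        rw [indexSq, Finset.mul_sum]
        simp only [mul_add, Finset.sum_add_distrib]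
        simp
        ring

end Cells

/-! ### Young's inequality for sequences -/

section DiscreteYoung

variable {ι : Type*} {p : ℝ}

/-- Hölder's inequality with respect to the weight `w`. -/
theorem tsum_mul_rpow_le (hp : 1 ≤ p) (w f : ι → ℝ≥0∞) :
    (∑' j, w j * f j) ^ p ≤ (∑' j, w j) ^ (p - 1) * ∑' j, w j * f j ^ p := by
  have hp0 : 0 < p := one_pos.trans_le hp
  have h1p : 0 ≤ 1 - p⁻¹ := sub_nonneg.2 (inv_le_one_of_one_le₀ hp)
  have h : ∑' j, w j * f j ≤ (∑' j, w j) ^ (1 - p⁻¹) * (∑' j, w j * f j ^ p) ^ p⁻¹ := by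
    rw [ENNReal.tsum_eq_iSup_sum]
    refine iSup_le fun s => (ENNReal.inner_le_weight_mul_Lp_of_nonneg s hp w f).trans ?_
    gcongr <;> exact ENNReal.sum_le_tsum s
  calc (∑' j, w j * f j) ^ p ≤ ((∑' j, w j) ^ (1 - p⁻¹) * (∑' j, w j * f j ^ p) ^ p⁻¹) ^ p := by
        gcongr
    _ = _ := by
        rw [ENNReal.mul_rpow_of_nonneg _ _ hp0.le, ← ENNReal.rpow_mul, ← ENNReal.rpow_mul,
          inv_mul_cancel₀ hp0.ne', ENNReal.rpow_one, sub_mul, inv_mul_cancel₀ hp0.ne', one_mul]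

/-- Young's inequality for convolutions with `ℓ¹` sequences. -/
theorem tsum_convolution_rpow_le [AddCommGroup ι] (hp : 1 ≤ p) (s f : ι → ℝ≥0∞) :
    ∑' i, (∑' j, s (i - j) * f j) ^ p ≤ (∑' m, s m) ^ p * ∑' j, f j ^ p := by
  have h1 : ∀ i, ∑' j, s (i - j) = ∑' m, s m := fun i => (Equiv.subLeft i).tsum_eq s
  have h2 : ∀ j, ∑' i, s (i - j) = ∑' m, s m := fun j => (Equiv.subRight j).tsum_eq s
  calc ∑' i, (∑' j, s (i - j) * f j) ^ p
      ≤ ∑' i, (∑' m, s m) ^ (p - 1) * ∑' j, s (i - j) * f j ^ p :=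
        ENNReal.tsum_le_tsum fun i => by
          rw [← h1 i]; exact tsum_mul_rpow_le hp _ _
    _ = (∑' m, s m) ^ (p - 1) * ((∑' m, s m) * ∑' j, f j ^ p) := by
        rw [ENNReal.tsum_mul_left, ENNReal.tsum_comm]
        simp only [ENNReal.tsum_mul_right, h2, ENNReal.tsum_mul_left]
    _ = _ := by
        rw [← mul_assoc]
        congr 1
        nth_rewrite 2 [← ENNReal.rpow_one (∑' m, s m)]
        rw [← ENNReal.rpow_add_of_nonneg _ _ (by linarith) zero_le_one, sub_add_cancel]

end DiscreteYoung

/-! ### From the `A_{p,r}` condition to boundedness of `P⁺_{α,W}` -/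

section UpperBound

open Filter

variable {n d : ℕ} {α p r : ℝ} {W : Cn n → Matrix (Fin d) (Fin d) ℂ} {C : ℝ≥0} {g : Cn n → Cd d}

/-- `g` multiplied by the square root of the Gaussian. -/
def gaussianTwist (α : ℝ) (g : Cn n → Cd d) (u : Cn n) : Cd d :=
  ((Real.exp (-(α / 2) * sqNorm u) : ℝ) : ℂ) • g u

theorem enorm_exp (x : ℝ) : ‖((Real.exp x : ℝ) : ℂ)‖ₑ = ENNReal.ofReal (Real.exp x) := by
  rw [← ofReal_norm, Complex.norm_of_nonneg (Real.exp_pos _).le]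

theorem aestronglyMeasurable_gaussianTwist (hg : AEStronglyMeasurable g volume) :
    AEStronglyMeasurable (gaussianTwist α g) volume := by
  have := continuous_sqNorm (n := n)
  exact (by fun_prop : Continuous fun u : Cn n =>
    ((Real.exp (-(α / 2) * sqNorm u) : ℝ) : ℂ)).aestronglyMeasurable.smul hg

theorem normLp_eq_eLpNorm (hp : 0 < p) :
    normLp α p g = eLpNorm (gaussianTwist α g) (ENNReal.ofReal p) volume := by
  rw [normLp, lpNorm_eq_eLpNorm hp]
  refine eLpNorm_congr_enorm_ae (Eventually.of_forall fun u => ?_)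
  rw [enorm_eq_self, gaussianTwist, enorm_smul, enorm_exp, mul_comm]

/-- Completing the square: `-α|u|² + α Re⟨z,u⟩ - (α/2)|z|² = -(α/2)|z-u|² - (α/2)|u|²`, and the last
term goes into `gaussianTwist`. -/
theorem maxFockProj_mul_exp (z : Cn n) :
    maxFockProj α p W g z * ENNReal.ofReal (Real.exp (-(α / 2) * sqNorm z)) =
      ∫⁻ u, ENNReal.ofReal ((α / Real.pi) ^ n * Real.exp (-(α / 2) * sqNorm (z - u))) *
        ‖mpow (W z) (1 / p) (mpow (W u) (-(1 / p)) (gaussianTwist α g u))‖ₑ := by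
  rw [maxFockProj, lintegral_gaussian, ← lintegral_mul_const' _ _ ENNReal.ofReal_ne_top]
  refine lintegral_congr fun u => ?_
  rw [gaussianTwist, map_smul, map_smul, enorm_smul, enorm_exp, ← ofReal_norm (kernel α z u),
    norm_kernel]
  set w := ‖mpow (W z) (1 / p) (mpow (W u) (-(1 / p)) (g u))‖ₑ
  have h : gaussianDensity n α u * Real.exp (α * (herm z u).re) *
      Real.exp (-(α / 2) * sqNorm z) = (α / Real.pi) ^ n *
        Real.exp (-(α / 2) * sqNorm (z - u)) * Real.exp (-(α / 2) * sqNorm u) := by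
    rw [gaussianDensity, sqNorm_sub]
    simp only [mul_assoc, ← Real.exp_add]
    congr 2
    ring
  calc _ = ENNReal.ofReal (gaussianDensity n α u) *
        ENNReal.ofReal (Real.exp (α * (herm z u).re)) *
        ENNReal.ofReal (Real.exp (-(α / 2) * sqNorm z)) * w := by ring
    _ = ENNReal.ofReal ((α / Real.pi) ^ n * Real.exp (-(α / 2) * sqNorm (z - u))) *
        ENNReal.ofReal (Real.exp (-(α / 2) * sqNorm u)) * w := by
        rw [← ENNReal.ofReal_mul' (Real.exp_pos _).le, ← ENNReal.ofReal_mul' (Real.exp_pos _).le,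
          h, ENNReal.ofReal_mul' (Real.exp_pos _).le]
    _ = _ := by ring

/-- Expanding the inner vector in the basis and moving the self-adjoint `M'^t` onto `b'` separates
the factor in `M` from the factor in `M'`. -/
theorem enorm_mpow_mpow_le {b b' : Fin d → Cd d} (hbb' : ∀ y, y = ∑ k, inner ℂ (b' k) y • b k)
    (M M' : Matrix (Fin d) (Fin d) ℂ) (s t : ℝ) (h : Cd d) :
    ‖mpow M s (mpow M' t h)‖ₑ ≤ ∑ k, ‖mpow M s (b k)‖ₑ * (‖mpow M' t (b' k)‖ₑ * ‖h‖ₑ) := by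
  conv_lhs => rw [hbb' (mpow M' t h), map_sum]
  refine (enorm_sum_le _ _).trans (Finset.sum_le_sum fun k _ => ?_)
  rw [map_smul, enorm_smul, mul_comm, ← inner_mpow]
  exact mul_le_mul_right (enorm_inner_le _ _) _

theorem rpow_le_one_add {v : ℝ≥0∞} {s : ℝ} (hs : s ≤ 1) (hs0 : 0 ≤ s) : v ^ s ≤ 1 + v := by
  rcases le_total v 1 with h | h
  · exact (ENNReal.rpow_le_one h hs0).trans le_self_add
  · exact (ENNReal.rpow_le_rpow_of_exponent_le h hs).trans
      ((ENNReal.rpow_one v).le.trans le_add_self)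

/-- A crude factor for passing from normalized to unnormalized measure on cubes. -/
def volumeFactor (n : ℕ) (r : ℝ) : ℝ≥0∞ := 1 + ENNReal.ofReal ((r ^ 2) ^ n)

theorem eLpNorm_cell_le {E : Type*} [NormedAddCommGroup E] (hr : 0 < r) (m : Fin n → ℤ × ℤ)
    {q : ℝ≥0∞} (hq : 1 ≤ q) (f : Cn n → E) :
    eLpNorm f q (volume.restrict (cell r m)) ≤
      volumeFactor n r * eLpNorm f q (avgMeasure r (cellCenter r m)) := by
  have h0 := volume_cube_ne_zero hr (cellCenter r m)
  have ht := volume_cube_ne_top hr (cellCenter r m)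
  have h : volume.restrict (cube r (cellCenter r m))
      = volume (cube r (cellCenter r m)) • avgMeasure r (cellCenter r m) := by
    rw [avgMeasure, smul_smul, ENNReal.mul_inv_cancel h0 ht, one_smul]
  refine (eLpNorm_mono_measure f (Measure.restrict_mono_set _ (cell_subset_cube hr m))).trans ?_
  rw [h, eLpNorm_smul_measure_of_ne_zero h0, smul_eq_mul, volumeFactor, ← volume_cube hr]
  refine mul_le_mul_left (rpow_le_one_add ?_ ENNReal.toReal_nonneg) _
  rw [one_div]
  exact ENNReal.toReal_mono ENNReal.one_ne_top (ENNReal.inv_le_one.2 hq)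

/-- Hölder's inequality on the cell, whose `L^{p'}` factor is enlarged to the average over the
surrounding cube. -/
theorem setLIntegral_cell_le (hW : IsMatrixWeight W) (hp : 1 ≤ p) (hr : 0 < r)
    {f : Cn n → Cd d} (hf : AEStronglyMeasurable f volume) (m : Fin n → ℤ × ℤ) (x : Cd d) :
    ∫⁻ u in cell r m, ‖mpow (W u) (-(1 / p)) x‖ₑ * ‖f u‖ₑ ≤
      volumeFactor n r * dualAvg p r W (cellCenter r m) x *
        eLpNorm f (ENNReal.ofReal p) (volume.restrict (cell r m)) := by
  have hpq := ENNReal.HolderConjugate.conjExponent (p := ENNReal.ofReal p) (by simpa using hp)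
  have hm : AEStronglyMeasurable (fun u => mpow (W u) (-(1 / p)) x) (volume.restrict (cell r m)) :=
    (aestronglyMeasurable_mpow_apply hW _ aestronglyMeasurable_const).restrict
  have h := eLpNorm_le_eLpNorm_mul_eLpNorm_of_nnnorm hm hf.restrict
    (fun a b => ‖a‖ * ‖b‖) 1 (r := 1) (q := ENNReal.ofReal p)
    (p := (ENNReal.ofReal p).conjExponent)
    (Eventually.of_forall fun z => by simp)
    (hpqr := hpq.symm)
  rw [ENNReal.coe_one, one_mul, eLpNorm_one_eq_lintegral_enorm] at h
  simp only [enorm_mul, enorm_norm] at h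
  refine h.trans (mul_le_mul_left (eLpNorm_cell_le hr m ?_ _) _)
  exact ENNReal.HolderConjugate.one_le _ (ENNReal.ofReal p)

/-- The rate of Gaussian decay in terms of cell indices. -/
def decayRate (α r : ℝ) : ℝ := α * r ^ 2 / 4

/-- The size of the off-diagonal interactions of cells. -/
def chainFactor (n : ℕ) (α r : ℝ) (C : ℝ≥0) : ℝ :=
  (α / Real.pi) ^ n *
    Real.exp (α * r ^ 2 * n + 4 * n * Real.log (16 ^ n * C) ^ 2 / decayRate α r)

/-- The Gaussian is at most `e^{αr²n - γ|m|²}` in terms of the index difference `m`, with `γ` the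
decay rate. Half of this decay pays for the chain and half is left for summation. -/
theorem exp_mul_pow_le (hα : 0 < α) (hr : 0 < r) (hC : 1 ≤ C) {i j : Fin n → ℤ × ℤ} {z u : Cn n}
    (hz : z ∈ cell r i) (hu : u ∈ cell r j) :
    ENNReal.ofReal ((α / Real.pi) ^ n * Real.exp (-(α / 2) * sqNorm (z - u))) *
        ((16 ^ n * C : ℝ≥0∞)) ^ indexSteps (i - j) ≤
      ENNReal.ofReal (chainFactor n α r C) *
        ENNReal.ofReal (Real.exp (-(decayRate α r / 2) * indexSq (i - j))) := by
  have hpi := Real.pi_pos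
  have hC' : (1 : ℝ) ≤ C := by exact_mod_cast hC
  have h16 : (1 : ℝ) ≤ 16 ^ n * C := by
    have : (1 : ℝ) ≤ 16 ^ n := one_le_pow₀ (by norm_num)
    nlinarith
  have hγ : 0 < decayRate α r := by unfold decayRate; positivity
  have e : (16 ^ n * C : ℝ≥0∞) = ENNReal.ofReal (16 ^ n * C) := by
    rw [ENNReal.ofReal_mul (by positivity), ENNReal.ofReal_coe_nnreal,
      ENNReal.ofReal_pow (by norm_num), ENNReal.ofReal_ofNat]
  rw [e, ← ENNReal.ofReal_pow (by positivity), ← ENNReal.ofReal_mul (by positivity),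
    ← ENNReal.ofReal_mul (by unfold chainFactor; positivity)]
  refine ENNReal.ofReal_le_ofReal ?_
  have hpow : ((16 : ℝ) ^ n * C) ^ indexSteps (i - j)
      = Real.exp (Real.log (16 ^ n * C) * indexSteps (i - j)) := by
    rw [Real.exp_mul, Real.exp_log (by positivity), Real.rpow_natCast]
  rw [hpow, chainFactor, mul_assoc, mul_assoc, ← Real.exp_add, ← Real.exp_add]
  refine mul_le_mul_of_nonneg_left (Real.exp_le_exp.2 ?_) (by positivity)
  have h1 := mul_indexSteps_le (L := Real.log (16 ^ n * C)) hγ (i - j)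
  have h2 := le_sqNorm_sub_of_mem_cell hr hz hu
  have h3 : -(α / 2) * sqNorm (z - u) ≤ -(α / 2) * (r ^ 2 * (indexSq (i - j) / 2 - 2 * n)) :=
    mul_le_mul_of_nonpos_left h2 (by linarith)
  have h4 : -(α / 2) * (r ^ 2 * (indexSq (i - j) / 2 - 2 * n))
      = α * r ^ 2 * n - decayRate α r * indexSq (i - j) := by
    rw [decayRate]; ring
  linarith

/-- The basis is adapted to the cell of `z`. For the part of the integral over cell `j`, the bound
of the dual basis is carried along a chain to cell `j`, where the `A_{p,r}` condition makes it
usable in Hölder's inequality. -/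
theorem maxFockProj_le_on_cell (hW : IsMatrixWeight W) (hd : 0 < d) (hα : 0 < α) (hp : 1 ≤ p)
    (hr : 0 < r) (hC : AprBound p r (weightMetric p W) C) (hg : AEStronglyMeasurable g volume)
    {i : Fin n → ℤ × ℤ} {b b' : Fin d → Cd d} (hbb' : ∀ y, y = ∑ k, inner ℂ (b' k) y • b k)
    (hb' : ∀ k, dualNorm (primalAvg p r W (cellCenter r i)) (b' k) ≤ 2) {z : Cn n}
    (hz : z ∈ cell r i) :
    maxFockProj α p W g z * ENNReal.ofReal (Real.exp (-(α / 2) * sqNorm z)) ≤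
      ENNReal.ofReal (chainFactor n α r C) * volumeFactor n r * C * 2 *
        (∑' j, ENNReal.ofReal (Real.exp (-(decayRate α r / 2) * indexSq (i - j))) *
          eLpNorm (gaussianTwist α g) (ENNReal.ofReal p) (volume.restrict (cell r j))) *
        ∑ k, ‖mpow (W z) (1 / p) (b k)‖ₑ := by
  have hC1 := one_le_of_aprBound hW hd hp hr hC
  have hgt := aestronglyMeasurable_gaussianTwist (α := α) hg
  set G := gaussianTwist α g
  have hmeas : ∀ j k, AEMeasurable (fun u => ‖mpow (W u) (-(1 / p)) (b' k)‖ₑ * ‖G u‖ₑ)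
      (volume.restrict (cell r j)) := fun j k =>
    ((aestronglyMeasurable_mpow_apply hW _ aestronglyMeasurable_const).restrict.enorm).mul
      hgt.restrict.enorm
  have hD : ((16 ^ n * C : ℝ≥0∞)) ≠ 0 := by
    have : C ≠ 0 := (one_pos.trans_le hC1).ne'
    simp [this]
  have hDt : ((16 ^ n * C : ℝ≥0∞)) ≠ ∞ := ENNReal.mul_ne_top (by simp) ENNReal.coe_ne_top
  have hcell : ∀ j, ∫⁻ u in cell r j,
      ENNReal.ofReal ((α / Real.pi) ^ n * Real.exp (-(α / 2) * sqNorm (z - u))) *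
        ‖mpow (W z) (1 / p) (mpow (W u) (-(1 / p)) (G u))‖ₑ ≤
      ENNReal.ofReal (chainFactor n α r C) * volumeFactor n r * C * 2 *
        (ENNReal.ofReal (Real.exp (-(decayRate α r / 2) * indexSq (i - j))) *
          eLpNorm G (ENNReal.ofReal p) (volume.restrict (cell r j))) *
        ∑ k, ‖mpow (W z) (1 / p) (b k)‖ₑ := by
    intro j
    set D := ((16 ^ n * C : ℝ≥0∞)) ^ indexSteps (i - j) with hDdef
    have hD0 : D ≠ 0 := pow_ne_zero _ hD
    have hD1 : D ≠ ∞ := ENNReal.pow_ne_top hDt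
    set K := ENNReal.ofReal (chainFactor n α r C) *
        ENNReal.ofReal (Real.exp (-(decayRate α r / 2) * indexSq (i - j))) with hK
    have hKt : K ≠ ∞ := ENNReal.mul_ne_top ENNReal.ofReal_ne_top ENNReal.ofReal_ne_top
    set Gj := eLpNorm G (ENNReal.ofReal p) (volume.restrict (cell r j))
    -- The `2` is the dual norm at cell `i`, `D` the cost of the chain from `i` to `j`, and `C` the
    -- `A_{p,r}` condition at `j`.
    have hdual : ∀ k, dualAvg p r W (cellCenter r j) (b' k) ≤ C * (D * 2) := by
      intro k
      obtain ⟨h, hh, hstep⟩ := exists_step hr i j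
      refine ((aprBound_iff hW).1 hC _ _).trans (mul_le_mul_right ?_ _)
      rw [hstep]
      exact (dualNorm_primalAvg_chain hW hp hr hC hh _ _ _).trans (mul_le_mul_right (hb' k) _)
    calc ∫⁻ u in cell r j,
          ENNReal.ofReal ((α / Real.pi) ^ n * Real.exp (-(α / 2) * sqNorm (z - u))) *
            ‖mpow (W z) (1 / p) (mpow (W u) (-(1 / p)) (G u))‖ₑ
        ≤ ∫⁻ u in cell r j, (K / D) * ∑ k, ‖mpow (W z) (1 / p) (b k)‖ₑ *
            (‖mpow (W u) (-(1 / p)) (b' k)‖ₑ * ‖G u‖ₑ) := by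
          refine setLIntegral_mono' (measurableSet_cell j) fun u hu => ?_
          refine mul_le_mul' ?_ (enorm_mpow_mpow_le hbb' _ _ _ _ _)
          rw [ENNReal.le_div_iff_mul_le (Or.inl hD0) (Or.inl hD1)]
          exact exp_mul_pow_le hα hr hC1 hz hu
      _ = (K / D) * ∑ k, ‖mpow (W z) (1 / p) (b k)‖ₑ *
            ∫⁻ u in cell r j, ‖mpow (W u) (-(1 / p)) (b' k)‖ₑ * ‖G u‖ₑ := by
          rw [lintegral_const_mul' _ _ (ENNReal.div_ne_top hKt hD0),
            lintegral_finsetSum' _ fun k _ => (hmeas j k).const_mul _]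
          congr 1
          refine Finset.sum_congr rfl fun k _ => ?_
          rw [lintegral_const_mul' _ _ (by simp)]
      _ ≤ (K / D) * ∑ k, ‖mpow (W z) (1 / p) (b k)‖ₑ *
            (volumeFactor n r * (C * (D * 2)) * Gj) := by
          gcongr with k
          refine (setLIntegral_cell_le hW hp hr hgt j (b' k)).trans ?_
          gcongr
          exact hdual k
      -- The kernel bound was written as `K / D` so that the cost of the chain cancels here.
      _ = K / D * D * (volumeFactor n r * C * 2 * Gj * ∑ k, ‖mpow (W z) (1 / p) (b k)‖ₑ) := by
          rw [← Finset.sum_mul]; ring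
      _ = _ := by
          rw [ENNReal.div_mul_cancel hD0 hD1, hK]; ring
  rw [maxFockProj_mul_exp, lintegral_eq_tsum_cell r]
  refine (ENNReal.tsum_le_tsum hcell).trans_eq ?_
  rw [ENNReal.tsum_mul_right, ENNReal.tsum_mul_left]

theorem eLpNorm_rpow_eq_lintegral {E : Type*} [NormedAddCommGroup E] (hp : 0 < p) (f : Cn n → E)
    (μ : Measure (Cn n)) :
    eLpNorm f (ENNReal.ofReal p) μ ^ p = ∫⁻ z, ‖f z‖ₑ ^ p ∂μ := by
  rw [eLpNorm_eq_lintegral_rpow_enorm_toReal (by simpa using hp) (by simp),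
    ENNReal.toReal_ofReal hp.le, ← ENNReal.rpow_mul, one_div_mul_cancel hp.ne', ENNReal.rpow_one]

/-- Minkowski's inequality for `d` vectors of averaged norm at most `1`. This is the only source of
the dimension. -/
theorem lintegral_cell_sum_rpow_le (hW : IsMatrixWeight W) (hp : 1 ≤ p) (hr : 0 < r)
    {i : Fin n → ℤ × ℤ} {b : Fin d → Cd d}
    (hb : ∀ k, primalAvg p r W (cellCenter r i) (b k) ≤ 1) :
    ∫⁻ z in cell r i, (∑ k, ‖mpow (W z) (1 / p) (b k)‖ₑ) ^ p ≤ (volumeFactor n r * d) ^ p := by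
  have hp0 : 0 < p := one_pos.trans_le hp
  have h1 : ∀ z, ∑ k, ‖mpow (W z) (1 / p) (b k)‖ₑ
      = ‖(∑ k, fun z => ‖mpow (W z) (1 / p) (b k)‖) z‖ₑ := fun z => by
    rw [Finset.sum_apply, ← ofReal_norm, Real.norm_of_nonneg (Finset.sum_nonneg fun _ _ =>
      norm_nonneg _), ENNReal.ofReal_sum_of_nonneg fun _ _ => norm_nonneg _]
    simp only [ofReal_norm]
  simp only [h1]
  rw [← eLpNorm_rpow_eq_lintegral hp0]
  refine ENNReal.rpow_le_rpow ?_ hp0.le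
  refine (eLpNorm_sum_le (fun k _ => ((aestronglyMeasurable_mpow_apply hW _
    aestronglyMeasurable_const).restrict.norm)) (by simpa using hp)).trans ?_
  calc _ ≤ ∑ _k : Fin d, volumeFactor n r * 1 := Finset.sum_le_sum fun k _ => by
        rw [eLpNorm_norm]
        exact (eLpNorm_cell_le hr i (by simpa using hp) _).trans (mul_le_mul_right (hb k) _)
    _ = volumeFactor n r * d := by simp [mul_comm]

theorem aemeasurable_maxFockProj (hW : IsMatrixWeight W) (hg : AEStronglyMeasurable g volume) :
    AEMeasurable (maxFockProj α p W g) volume := by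
  have h1 := aestronglyMeasurable_mpow_weight hW (1 / p)
  have h2 := aestronglyMeasurable_mpow_apply hW (-(1 / p)) hg
  have hm : Measurable fun z => ∫⁻ u, ‖h1.mk _ z (h2.mk _ u)‖ₑ * ‖kernel α z u‖ₑ ∂(gaussian n α) := by
    refine Measurable.lintegral_prod_right'
      (f := fun q : Cn n × Cn n => ‖h1.mk _ q.1 (h2.mk _ q.2)‖ₑ * ‖kernel α q.1 q.2‖ₑ) ?_
    refine Measurable.mul ?_ continuous_kernel.measurable.enorm
    exact (isBoundedBilinearMap_apply.continuous.comp_stronglyMeasurable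
      ((h1.stronglyMeasurable_mk.comp_measurable measurable_fst).prodMk
        (h2.stronglyMeasurable_mk.comp_measurable measurable_snd))).enorm
  refine ⟨_, hm, ?_⟩
  filter_upwards [h1.ae_eq_mk] with z hz
  refine lintegral_congr_ae ?_
  filter_upwards [gaussian_absolutelyContinuous.ae_le h2.ae_eq_mk] with u hu
  rw [← hz, ← hu]

/-- The quantitative bound of the maximal Fock projection. -/
def upperFactor (n d : ℕ) (α r : ℝ) (C : ℝ≥0) : ℝ≥0∞ :=
  ENNReal.ofReal (chainFactor n α r C) * volumeFactor n r * C * 2 * (volumeFactor n r * d) *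
    indexSum n (decayRate α r / 2)

/-- With a separate basis for each cell, the `L^p` norms over cells are bounded by the convolution
of a Gaussian sequence with the cell norms of `g`; Young's inequality sums them. -/
theorem lpNorm_maxFockProj_le (hW : IsMatrixWeight W) (hd : 0 < d) (hα : 0 < α) (hp : 1 ≤ p)
    (hr : 0 < r) (hC : AprBound p r (weightMetric p W) C) (hg : AEStronglyMeasurable g volume) :
    lpNorm α p (maxFockProj α p W g) ≤ upperFactor n d α r C * normLp α p g := by
  have hp0 : 0 < p := one_pos.trans_le hp
  rw [← ENNReal.rpow_le_rpow_iff hp0, normLp_eq_eLpNorm hp0, ENNReal.mul_rpow_of_nonneg _ _ hp0.le,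
    eLpNorm_rpow_eq_lintegral hp0, lintegral_eq_tsum_cell r, lpNorm_eq_eLpNorm hp0,
    eLpNorm_eq_lintegral_rpow_enorm_toReal (by simpa using hp0) (by simp),
    ENNReal.toReal_ofReal hp0.le, ← ENNReal.rpow_mul, one_div_mul_cancel hp0.ne', ENNReal.rpow_one,
    lintegral_eq_tsum_cell r]
  simp only [← eLpNorm_rpow_eq_lintegral hp0, enorm_eq_self]
  set B := ENNReal.ofReal (chainFactor n α r C) * volumeFactor n r * C * 2 with hB
  set s : (Fin n → ℤ × ℤ) → ℝ≥0∞ := fun m =>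
    ENNReal.ofReal (Real.exp (-(decayRate α r / 2) * indexSq m)) with hs
  set G : (Fin n → ℤ × ℤ) → ℝ≥0∞ := fun j =>
    eLpNorm (gaussianTwist α g) (ENNReal.ofReal p) (volume.restrict (cell r j)) with hG
  have hcell : ∀ i, ∫⁻ z in cell r i, (maxFockProj α p W g z *
      ENNReal.ofReal (Real.exp (-(α / 2) * sqNorm z))) ^ p ≤
        (B * (volumeFactor n r * d)) ^ p * (∑' j, s (i - j) * G j) ^ p := by
    intro i
    obtain ⟨c, hc, hcN⟩ := exists_mul_le_primalAvg hW hp hr (cellCenter r i)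
    obtain ⟨b, b', hb, hb', hbb'⟩ := exists_near_auerbach_basis hc hcN
      (primalAvg_lt_top hW hp hr _) (primalAvg_smul (p := p) (r := r) (W := W) (cellCenter r i))
    have hmeas : AEMeasurable (fun z => (∑ k, ‖mpow (W z) (1 / p) (b k)‖ₑ) ^ p)
        (volume.restrict (cell r i)) :=
      (Finset.aemeasurable_fun_sum _ fun k _ => (aestronglyMeasurable_mpow_apply hW _
        aestronglyMeasurable_const).restrict.enorm).pow_const p
    calc _ ≤ ∫⁻ z in cell r i, (B * ∑' j, s (i - j) * G j) ^ p *
            (∑ k, ‖mpow (W z) (1 / p) (b k)‖ₑ) ^ p := by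
          refine setLIntegral_mono' (measurableSet_cell i) fun z hz => ?_
          rw [← ENNReal.mul_rpow_of_nonneg _ _ hp0.le]
          exact ENNReal.rpow_le_rpow
            (maxFockProj_le_on_cell hW hd hα hp hr hC hg hbb' hb' hz) hp0.le
      _ = (B * ∑' j, s (i - j) * G j) ^ p *
            ∫⁻ z in cell r i, (∑ k, ‖mpow (W z) (1 / p) (b k)‖ₑ) ^ p :=
          lintegral_const_mul'' _ hmeas
      _ ≤ (B * ∑' j, s (i - j) * G j) ^ p * (volumeFactor n r * d) ^ p :=
          mul_le_mul_right (lintegral_cell_sum_rpow_le hW hp hr hb) _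
      _ = _ := by
          rw [← ENNReal.mul_rpow_of_nonneg _ _ hp0.le, ← ENNReal.mul_rpow_of_nonneg _ _ hp0.le]
          congr 1
          ring
  calc _ ≤ ∑' i, (B * (volumeFactor n r * d)) ^ p * (∑' j, s (i - j) * G j) ^ p :=
        ENNReal.tsum_le_tsum hcell
    _ = (B * (volumeFactor n r * d)) ^ p * ∑' i, (∑' j, s (i - j) * G j) ^ p :=
        ENNReal.tsum_mul_left
    _ ≤ (B * (volumeFactor n r * d)) ^ p * ((∑' m, s m) ^ p * ∑' j, G j ^ p) :=
        mul_le_mul_right (tsum_convolution_rpow_le hp s G) _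
    _ = _ := by
        rw [← mul_assoc, ← ENNReal.mul_rpow_of_nonneg _ _ hp0.le]
        rfl

end UpperBound

/-! ### Explicit form of the constants -/

section Constants

variable {n d : ℕ} {α p r : ℝ} {W : Cn n → Matrix (Fin d) (Fin d) ℂ} {C : ℝ≥0}

theorem decayRate_pos (hα : 0 < α) (hr : 0 < r) : 0 < decayRate α r := by
  unfold decayRate; positivity

theorem upperFactor_lt_top (hα : 0 < α) (hr : 0 < r) (C : ℝ≥0) : upperFactor n d α r C < ∞ := by
  have hV : volumeFactor n r < ∞ := ENNReal.add_lt_top.2 ⟨ENNReal.one_lt_top, ENNReal.ofReal_lt_top⟩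
  unfold upperFactor
  refine ENNReal.mul_lt_top (ENNReal.mul_lt_top (ENNReal.mul_lt_top (ENNReal.mul_lt_top
    (ENNReal.mul_lt_top ENNReal.ofReal_lt_top hV) ENNReal.coe_lt_top) (by simp))
    (ENNReal.mul_lt_top hV (by simp))) (indexSum_lt_top (half_pos (decayRate_pos hα hr)))

theorem maxFockProjBound_of_aprBound (hW : IsMatrixWeight W) (hd : 0 < d) (hα : 0 < α)
    (hp : 1 ≤ p) (hr : 0 < r) (hC : AprBound p r (weightMetric p W) C) :
    MaxFockProjBound α p W (upperFactor n d α r C).toNNReal := fun g hg => by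
  refine ⟨aemeasurable_maxFockProj hW hg.1, ?_⟩
  rw [ENNReal.coe_toNNReal (upperFactor_lt_top hα hr C).ne]
  exact lpNorm_maxFockProj_le hW hd hα hp hr hC hg.1

theorem maxFockProjNorm_le_upperFactor (hW : IsMatrixWeight W) (hd : 0 < d) (hα : 0 < α)
    (hp : 1 ≤ p) (hr : 0 < r) (h : IsAprWeight p r W) :
    maxFockProjNorm α p W ≤ upperFactor n d α r (aprConst p r W).toNNReal :=
  iInf₂_le_of_le _ (maxFockProjBound_of_aprBound hW hd hα hp hr
    (aprBound_toNNReal_aprConst hW hp hr h)) (ENNReal.coe_toNNReal (upperFactor_lt_top hα hr _).ne).le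

/-- The factor `c` in the upper estimate of `‖P⁺_{α,W}‖`. -/
def upperConst (n : ℕ) (α r : ℝ) : ℝ :=
  -- The entries bound, in turn, the exponent of the single factor `C`, the coefficient of `log² C`,
  -- and everything independent of `C` and `d`.
  max 1 (max (8 * n / decayRate α r)
    ((α / Real.pi) ^ n *
      Real.exp (α * r ^ 2 * n + 8 * n * (n * Real.log 16) ^ 2 / decayRate α r) *
      (1 + (r ^ 2) ^ n) ^ 2 * 2 * (indexSum n (decayRate α r / 2)).toReal))

theorem one_le_upperConst (n : ℕ) (α r : ℝ) : 1 ≤ upperConst n α r := le_max_left _ _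

/-- Here `log(16^n C) = n log 16 + log C`, and `(a + b)² ≤ 2a² + 2b²` turns the `4n` into `8n`. -/
theorem chainFactor_le (hα : 0 < α) (hr : 0 < r) (hC : 1 ≤ C) :
    chainFactor n α r C ≤ (α / Real.pi) ^ n *
      Real.exp (α * r ^ 2 * n + 8 * n * (n * Real.log 16) ^ 2 / decayRate α r) *
      Real.exp (8 * n / decayRate α r * Real.log C ^ 2) := by
  have hpi := Real.pi_pos
  have hγ := decayRate_pos hα hr
  have hC0 : (0 : ℝ) < C := by exact_mod_cast one_pos.trans_le hC
  rw [chainFactor, mul_assoc (_ ^ n), ← Real.exp_add]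
  refine mul_le_mul_of_nonneg_left (Real.exp_le_exp.2 ?_) (by positivity)
  rw [Real.log_mul (by positivity) hC0.ne', Real.log_pow, add_assoc]
  refine add_le_add_right ?_ _
  rw [div_mul_eq_mul_div, ← add_div]
  gcongr
  set a := n * Real.log 16
  set b := Real.log C
  have hn : (0 : ℝ) ≤ n := Nat.cast_nonneg n
  nlinarith [mul_nonneg hn (sq_nonneg (a - b))]

theorem one_le_dimExp (p : ℝ) : 1 ≤ dimExp p := by
  unfold dimExp; split_ifs <;> norm_num

/-- Since `e^{c log² C} = C^{c log C}`, the remaining factor `C` and the chain together are at most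
`C^{c(1 + log C)}`. The dimension occurs to the first power, and `d ≥ 1`. -/
theorem upperFactor_le (hd : 0 < d) (hα : 0 < α) (hr : 0 < r) (hC : 1 ≤ C) (p : ℝ) :
    upperFactor n d α r C ≤ ENNReal.ofReal (upperConst n α r * (d : ℝ) ^ dimExp p *
      (C : ℝ) ^ (upperConst n α r * (1 + Real.log C))) := by
  have hpi := Real.pi_pos
  have hγ := decayRate_pos hα hr
  have hC1 : (1 : ℝ) ≤ C := by exact_mod_cast hC
  have hC0 : (0 : ℝ) < C := one_pos.trans_le hC1
  have hd1 : (1 : ℝ) ≤ d := by exact_mod_cast hd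
  have hch : 0 ≤ chainFactor n α r C := by unfold chainFactor; positivity
  have hS := (indexSum_lt_top (n := n) (half_pos hγ)).ne
  have hV : volumeFactor n r = ENNReal.ofReal (1 + (r ^ 2) ^ n) := by
    rw [volumeFactor, ENNReal.ofReal_add zero_le_one (by positivity), ENNReal.ofReal_one]
  have e : upperFactor n d α r C = ENNReal.ofReal (chainFactor n α r C * (1 + (r ^ 2) ^ n) * C * 2 *
      ((1 + (r ^ 2) ^ n) * d) * (indexSum n (decayRate α r / 2)).toReal) := by
    rw [ENNReal.ofReal_mul (by positivity), ENNReal.ofReal_mul (by positivity),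
      ENNReal.ofReal_mul (by positivity), ENNReal.ofReal_mul (by positivity),
      ENNReal.ofReal_mul (by positivity), ENNReal.ofReal_mul (by positivity),
      ENNReal.ofReal_toReal hS, ENNReal.ofReal_coe_nnreal, ENNReal.ofReal_natCast,
      ENNReal.ofReal_ofNat, ← hV, upperFactor]
  rw [e]
  refine ENNReal.ofReal_le_ofReal ?_
  set c := upperConst n α r with hc
  set S := (indexSum n (decayRate α r / 2)).toReal with hSdef
  set c₁ := (α / Real.pi) ^ n *
      Real.exp (α * r ^ 2 * n + 8 * n * (n * Real.log 16) ^ 2 / decayRate α r) *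
      (1 + (r ^ 2) ^ n) ^ 2 * 2 * S with hc₁
  have hS0 : 0 ≤ S := ENNReal.toReal_nonneg
  have h1 : c₁ ≤ c := (le_max_right _ _).trans (le_max_right _ _)
  have h2 : 8 * n / decayRate α r ≤ c := (le_max_left _ _).trans (le_max_right _ _)
  have h3 : 1 ≤ c := one_le_upperConst n α r
  have hl : 0 ≤ Real.log C := Real.log_nonneg hC1
  have hexp : (C : ℝ) * Real.exp (8 * n / decayRate α r * Real.log C ^ 2) ≤
      (C : ℝ) ^ (c * (1 + Real.log C)) := by
    rw [Real.rpow_def_of_pos hC0]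
    nth_rewrite 1 [← Real.exp_log hC0]
    rw [← Real.exp_add, Real.exp_le_exp]
    nlinarith [mul_le_mul_of_nonneg_right h2 (sq_nonneg (Real.log C)),
      mul_le_mul_of_nonneg_right h3 hl]
  have hdim : (d : ℝ) ≤ (d : ℝ) ^ dimExp p := by
    conv_lhs => rw [← Real.rpow_one (d : ℝ)]
    exact Real.rpow_le_rpow_of_exponent_le hd1 (one_le_dimExp p)
  calc _ ≤ ((α / Real.pi) ^ n *
          Real.exp (α * r ^ 2 * n + 8 * n * (n * Real.log 16) ^ 2 / decayRate α r) *
          Real.exp (8 * n / decayRate α r * Real.log C ^ 2)) * (1 + (r ^ 2) ^ n) * C * 2 *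
          ((1 + (r ^ 2) ^ n) * d) * S := by
        gcongr
        exact chainFactor_le hα hr hC
    _ = c₁ * d * (C * Real.exp (8 * n / decayRate α r * Real.log C ^ 2)) := by
        rw [hc₁]; ring
    _ ≤ _ := by gcongr

end Constants

end Fock

end

/-! ### The equivalences and the norm estimates -/

theorem theorem3p1 (n : ℕ) (hn : 0 < n) (α : ℝ) (hα : 0 < α) (p : ℝ) (hp : 1 ≤ p) :
    (∀ (d : ℕ), 0 < d → ∀ W : Fock.Cn n → Matrix (Fin d) (Fin d) ℂ, Fock.IsMatrixWeight W →
      List.TFAE [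
        Fock.FockProjBounded α p W,
        Fock.MaxFockProjBounded α p W,
        ∀ r : ℝ, 0 < r → Fock.IsAprWeight p r W,
        ∃ r : ℝ, 0 < r ∧ Fock.IsAprWeight p r W]) ∧
    (∀ r : ℝ, 0 < r → ∃ c : ℝ, 0 < c ∧
      ∀ (d : ℕ), 0 < d → ∀ W : Fock.Cn n → Matrix (Fin d) (Fin d) ℂ, Fock.IsMatrixWeight W →
        ENNReal.ofReal ((α * r ^ 2 / Real.pi) ^ n * Real.exp (-(n * α * r ^ 2))) *
            Fock.aprConst p r W ^ (1 / 2 : ℝ) ≤ Fock.fockProjNorm α p W ∧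
        Fock.fockProjNorm α p W ≤ Fock.maxFockProjNorm α p W ∧
        (Fock.IsAprWeight p r W →
          Fock.maxFockProjNorm α p W ≤
            ENNReal.ofReal (c * (d : ℝ) ^ Fock.dimExp p *
              (Fock.aprConst p r W).toReal ^
                (c * (1 + Real.log (Fock.aprConst p r W).toReal))))) := by
  refine ⟨fun d hd W hW => ?_, fun r hr => ⟨Fock.upperConst n α r,
    one_pos.trans_le (Fock.one_le_upperConst n α r), fun d hd W hW => ⟨?_, ?_, fun h => ?_⟩⟩⟩
  · tfae_have 1 → 3 := fun h r hr => Fock.isAprWeight_of_fockProjBounded hW hd hα hp hr h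
    tfae_have 3 → 4 := fun h => ⟨1, one_pos, h 1 one_pos⟩
    tfae_have 4 → 2 := fun ⟨r, hr, C, _, hC⟩ =>
      ⟨_, Fock.maxFockProjBound_of_aprBound hW hd hα hp hr hC⟩
    tfae_have 2 → 1 := fun ⟨C, hC⟩ => ⟨C, Fock.fockProjBound_of_maxFockProjBound hW hp hC⟩
    tfae_finish
  · exact Fock.lowerFactor_mul_sqrt_aprConst_le hW hd hα hp hr
  · exact Fock.fockProjNorm_le_maxFockProjNorm hW hp
  · exact (Fock.maxFockProjNorm_le_upperFactor hW hd hα hp hr h).trans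
      (Fock.upperFactor_le hd hα hr
        (Fock.one_le_of_aprBound hW hd hp hr (Fock.aprBound_toNNReal_aprConst hW hp hr h)) p)
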